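/- Let $\mathbb{K}\subseteq\mathbb{C}$ be a unital subring and let $R$ be a $\mathbb{K}$-algebra with a finite $\mathbb{K}$-basis $C=\{1=c_0,\dots,c_{r-1}\}$ such that $c_ic_j=\sum_k m_{i,j}^k c_k$ with all $m_{i,j}^k\in\mathbb{R}_{\ge 0}$ (a finite based $\mathbb{R}_{\ge0}$-algebra). Let $c=\sum_i a_ic_i$ with arbitrary $a_i\in\mathbb{R}_{\ge 0}$ and let $b_n$ be the sum of the coefficients of $c^n$ with respect to $C$ (computed in $\mathbb{C}\otimes_{\mathbb{K}}R$). Let $M=M(c)$ be the action matrix: the submatrix of $\big(\sum_i a_im_{i,j}^k\big)_{k,j}$ on the connected component (ignoring orientation) of $1\in C$ in the graph of that matrix. Then $M$ has a Perron–Frobenius eigenvalue $\lambda=\mathrm{PFdim}\,c\in\mathbb{R}_{\ge0}$, i.e. an eigenvalue with $\lambda\ge|\mu|$ for all eigenvalues $\mu$ of $M$. If $s$ is its algebraic multiplicity, there are periods $h_1,\dots,h_s\in\mathbb{Z}_{\ge1}$ such that the eigenvalues of $M$ of modulus $\lambda$, counted with multiplicity, are the numbers $\exp(2\pi i k/h_\ell)\lambda$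 with $1\le\ell\le s$, $0\le k<h_\ell$. Moreover $$\lim_{n\to\infty}\sqrt[n]{b_n}=\lambda .$$ If $\lambda=0$, then $b_n=0$ for all large $n$. Suppose $\lambda>0$ and put $h=\mathrm{lcm}(h_1,\dots,h_s)$, $\zeta=\exp(2\pi i/h)$; let $\nu$ be the maximal size of a Jordan block of $M$ with eigenvalue $\lambda$, and let $|\lambda^{sec}|$ be the largest modulus of an eigenvalue of $M$ of modulus $<\lambda$ ($0$ if there is none). Say that $f(n)\to l$ geometrically with ratio $\beta\in[0,1)$ if $(f(n)-l)/\gamma^n$ is bounded for every $\gamma\in(\beta,1)$. Then there are unique real matrices $S^0(n),\dots,S^{h-1}(n)$ whose entries are polynomials in $n$ of degree at most $\nu-1$, such that for each $i\in\{0,\dots,h-1\}$ the matrices $(M/\lambda)^{hn+i}-S^i(n)$ tend to $0$ entrywise, geometrically with ratio $|\lambda^{sec}/\lambda|^h$ (Rothblum's expansion). Writing $S^j(x)[1]$ for the sum of the entries of the column of $S^j(x)$ indexed by $1\in C$, and $$a(n)=\Big(\frac1h\sum_{i=0}^{h-1}\sum_{j=0}^{h-1}S^j\big(\lfloor n/h\rfloor\big)[1]\cdot\zeta^{i(n-j)}\Big)\cdot\lambda^n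 ,$$ we have $b_n\sim a(n)$, and $b_n/a(n)\to1$ geometrically with ratio $|\lambda^{sec}/\lambda|$. -/

import Mathlib

open scoped TensorProduct Polynomial NNReal

noncomputable section

/-- A finite based `ℝ≥0`-algebra over a unital subring `K ⊆ ℂ`: a `K`-algebra `R` with a finite
`K`-basis `C = (c_i)` containing the unit, all of whose structure constants are nonnegative reals. -/
structure FiniteBasedAlgebra (K : Subring ℂ) (R ι : Type*) [Ring R] [Algebra K R] where
  basis : Module.Basis ι K R
  /-- the index of the unit in the basis -/
  e : ι
  basis_e : basis e = 1
  nonneg : ∀ i j k, ∃ x : ℝ, 0 ≤ x ∧ ((basis.repr (basis i * basis j) k : K) : ℂ) = (x : ℂ)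

namespace FiniteBasedAlgebra

variable {K : Subring ℂ} {R ι : Type*} [Ring R] [Algebra K R] [Fintype ι]

/-- The structure constants: `c_i c_j = ∑ k, m_{i,j}^k c_k`. -/
def structConst (A : FiniteBasedAlgebra K R ι) (i j k : ι) : ℝ :=
  ((A.basis.repr (A.basis i * A.basis j) k : K) : ℂ).re

/-- The element `c = ∑ i, a_i c_i` with coefficients `a_i ∈ ℝ≥0`. The `a_i` need not lie in `K`,
so `c` lives in the scalar extension of `R` to `ℂ`, which has the same structure constants. -/
def elem (A : FiniteBasedAlgebra K R ι) (a : ι → ℝ≥0) : ℂ ⊗[K] R :=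
  ∑ i, (((a i : ℝ) : ℂ) ⊗ₜ[K] A.basis i)

/-- The coefficient of `c_k` in `c ^ n` (a nonnegative real number). -/
def powCoeff (A : FiniteBasedAlgebra K R ι) (a : ι → ℝ≥0) (n : ℕ) (k : ι) : ℝ :=
  ((Algebra.TensorProduct.basis ℂ A.basis).repr (A.elem a ^ n) k).re

/-- `b_n`: the total sum of the coefficients of `c ^ n`. -/
def b (A : FiniteBasedAlgebra K R ι) (a : ι → ℝ≥0) (n : ℕ) : ℝ :=
  ∑ k, A.powCoeff a n k

/-- The pre-action matrix `M'(c)_{k,j} = ∑ i, a_i m_{i,j}^k`. -/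
def preActionMatrix (A : FiniteBasedAlgebra K R ι) (a : ι → ℝ≥0) : Matrix ι ι ℝ :=
  Matrix.of fun k j => ∑ i, (a i : ℝ) * A.structConst i j k

/-- The connected component (ignoring orientations) of the unit in the graph of `M'(c)`. -/
def component (A : FiniteBasedAlgebra K R ι) (a : ι → ℝ≥0) : Set ι :=
  {j | Relation.EqvGen (fun x y => A.preActionMatrix a x y ≠ 0) A.e j}

instance (A : FiniteBasedAlgebra K R ι) (a : ι → ℝ≥0) : Fintype (A.component a) :=
  Fintype.ofFinite _

/-- The unit, as a vertex of its component. -/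
def unitVertex (A : FiniteBasedAlgebra K R ι) (a : ι → ℝ≥0) : A.component a :=
  ⟨A.e, Relation.EqvGen.refl _⟩

/-- The action matrix `M(c)`. -/
def actionMatrix (A : FiniteBasedAlgebra K R ι) (a : ι → ℝ≥0) :
    Matrix (A.component a) (A.component a) ℝ :=
  (A.preActionMatrix a).submatrix Subtype.val Subtype.val

end FiniteBasedAlgebra

section Matrices

variable {m : Type*} [Fintype m] [DecidableEq m]

/-- The complex eigenvalues of a real matrix, with algebraic multiplicity. -/
def eigs (M : Matrix m m ℝ) : Multiset ℂ :=
  (M.map Complex.ofReal).charpoly.roots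

/-- `lam` is the Perron--Frobenius eigenvalue: a nonnegative real eigenvalue that is at least the
modulus of every eigenvalue. -/
def IsPFEigenvalue (M : Matrix m m ℝ) (lam : ℝ) : Prop :=
  0 ≤ lam ∧ (lam : ℂ) ∈ eigs M ∧ ∀ μ ∈ eigs M, ‖μ‖ ≤ lam

open Classical in
/-- `hs = {h_1, …, h_s}` is the multiset of periods of `M`, where `s` is the multiplicity of the
Perron--Frobenius eigenvalue `lam`: the eigenvalues of modulus `lam`, with multiplicity, are the
numbers `exp (k 2πi / h_l) * lam` for `1 ≤ l ≤ s` and `0 ≤ k < h_l`. -/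
def IsPeriods (M : Matrix m m ℝ) (lam : ℝ) (hs : Multiset ℕ) : Prop :=
  Multiset.card hs = (eigs M).count (lam : ℂ) ∧
  (∀ h ∈ hs, 1 ≤ h) ∧
  (eigs M).filter (fun μ => ‖μ‖ = lam) =
    hs.bind fun h => (Multiset.range h).map fun k =>
      Complex.exp (k * (2 * Real.pi * Complex.I / h)) * (lam : ℂ)

/-- The modulus of a second largest eigenvalue: the largest modulus of an eigenvalue of modulus
`< lam`, and `0` if there is no such eigenvalue. -/
def secModulus (M : Matrix m m ℝ) (lam : ℝ) : ℝ :=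
  sSup {x : ℝ | ∃ μ ∈ eigs M, ‖μ‖ < lam ∧ x = ‖μ‖}

/-- The maximal size of a Jordan block of `M` with eigenvalue `lam`, i.e. the least `k` such that
`ker (M - lam) ^ k` is the whole generalized eigenspace. -/
def jordanIndex (M : Matrix m m ℝ) (lam : ℝ) : ℕ :=
  Module.End.maxGenEigenspaceIndex (Matrix.toLin' M) lam

/-- `f n → l` geometrically with ratio `β ∈ [0,1)`: for each `γ ∈ (β,1)` the sequence
`(f n - l) / γ ^ n` is bounded. -/
def ConvergesGeometrically {E : Type*} [NormedAddCommGroup E] (f : ℕ → E) (l : E) (β : ℝ) : Prop :=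
  0 ≤ β ∧ β < 1 ∧ ∀ γ : ℝ, β < γ → γ < 1 → ∃ B : ℝ, ∀ n, ‖f n - l‖ / γ ^ n ≤ B

/-- The polynomial matrices `S^0(n), …, S^{h-1}(n)` of Rothblum's expansion of the powers of
`M / lam`: the entries have degree at most `ν - 1`, and `(M / lam) ^ (h n + i) - S^i(n)` tends to
`0` entrywise, geometrically with ratio `|lam_sec / lam| ^ h`. -/
def IsRothblumExpansion (M : Matrix m m ℝ) (lam : ℝ) (h : ℕ)
    (S : Fin h → Matrix m m ℝ[X]) : Prop :=
  ∀ (i : Fin h) (k l : m),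
    (S i k l).natDegree ≤ jordanIndex M lam - 1 ∧
    Filter.Tendsto (fun n : ℕ => ((lam⁻¹ • M) ^ (h * n + (i : ℕ))) k l - (S i k l).eval (n : ℝ))
      Filter.atTop (nhds 0) ∧
    ConvergesGeometrically
      (fun n : ℕ => ((lam⁻¹ • M) ^ (h * n + (i : ℕ))) k l - (S i k l).eval (n : ℝ))
      0 ((secModulus M lam / lam) ^ h)

/-- `S[1]`: the sum of the entries in column `u` of the polynomial matrix `S`, evaluated at `x`. -/
def columnSum (S : Matrix m m ℝ[X]) (u : m) (x : ℝ) : ℝ :=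
  ∑ k, (S k u).eval x

/-- `a(n) = (1/h ∑_{i<h} ∑_{j<h} S^j(⌊n/h⌋)[1] ζ^{i(n-j)}) lam^n` with `ζ = exp (2πi/h)`. -/
def asymptoticFormula (lam : ℝ) (h : ℕ) (S : Fin h → Matrix m m ℝ[X]) (u : m) (n : ℕ) : ℂ :=
  (1 / (h : ℂ) * ∑ i : Fin h, ∑ j : Fin h,
    (columnSum (S j) u ((n / h : ℕ) : ℝ) : ℂ) *
      Complex.exp (2 * Real.pi * Complex.I / h) ^ (((i : ℕ) : ℤ) * ((n : ℤ) - ((j : ℕ) : ℤ)))) *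
    (lam : ℂ) ^ n

end Matrices

end

/-!
Let `M` be nonnegative with largest eigenvalue modulus `r > 0`. On an irreducible block an
eigenvector of an eigenvalue of modulus `r` has subinvariant entrywise moduli, hence invariant ones
by maximality of `r`; equality in the triangle inequality then conjugates `M` to a rotation of
itself, so the eigenvalues of modulus `r`, divided by `r`, form a finite group, that is, the `h`-th
roots of unity for some `h`. Reducing to irreducible blocks gives the periods.

For `T = M / r` and `h` the least common multiple of the periods, the Fitting idempotent `E` of
`T ^ h - 1` splits `T ^ (h * n + i)` into a unipotent part, polynomial in `n` by the binomial
theorem, and a part decaying like the powers of the largest eigenvalue modulus of `T` below `1`. The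
degree bound comes from nonnegativity: the leading coefficients on the residue classes are
nonnegative, so they cannot cancel each other.

The sum `b n` of the column of the unit is compared with all of `M ^ n` through the structure
constants, which gives `c * r ^ n ≤ b n` with `c > 0` and turns the additive errors of the expansion
into multiplicative ones.
-/

open Matrix Filter Asymptotics Topology

section GeometricConvergence

theorem isBigO_atTop_iff_forall_residue {E F : Type*} [Norm E] [SeminormedAddCommGroup F]
    {f : ℕ → E} {g : ℕ → F} {h : ℕ} (hh : h ≠ 0) :
    f =O[atTop] g ↔
      ∀ i : Fin h, (fun n : ℕ => f (h * n + i)) =O[atTop] fun n : ℕ => g (h * n + i) := by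
  constructor
  · intro hfg i
    exact hfg.comp_tendsto <| tendsto_atTop_mono (fun n => by
      simpa using Nat.le_add_right_of_le (Nat.le_mul_of_pos_left n (Nat.pos_of_ne_zero hh)))
      tendsto_id
  · intro hfg
    choose C hC using fun i => (hfg i).bound
    refine IsBigO.of_bound (∑ i, |C i|) ?_
    filter_upwards [(Nat.tendsto_div_const_atTop hh).eventually (eventually_all.2 hC)] with n hn
    have hnh := hn ⟨n % h, Nat.mod_lt n (Nat.pos_of_ne_zero hh)⟩
    simp only [Nat.div_add_mod] at hnh
    exact hnh.trans <| mul_le_mul_of_nonneg_right ((le_abs_self _).trans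
      (Finset.single_le_sum (fun i _ => abs_nonneg (C i)) (Finset.mem_univ _))) (norm_nonneg _)

theorem isTheta_pow_mul_add {γ : ℝ} (hγ : γ ≠ 0) (h i : ℕ) :
    (fun n : ℕ => γ ^ (h * n + i)) =Θ[atTop] fun n : ℕ => (γ ^ h) ^ n := by
  simp_rw [pow_add, mul_comm _ (γ ^ i), pow_mul]
  exact (isTheta_const_mul_left (pow_ne_zero i hγ)).2 isTheta_rfl

variable {E : Type*} [NormedAddCommGroup E] {f : ℕ → E} {l : E} {β : ℝ}

theorem convergesGeometrically_iff_isBigO :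
    ConvergesGeometrically f l β ↔ 0 ≤ β ∧ β < 1 ∧
      ∀ γ, β < γ → γ < 1 → (fun n => f n - l) =O[atTop] fun n => γ ^ n := by
  refine and_congr_right fun hβ => and_congr_right fun _ => forall₃_congr fun γ hγ _ => ?_
  have hγ0 : 0 < γ := hβ.trans_lt hγ
  rw [isBigO_nat_atTop_iff fun n hn => absurd hn (pow_pos hγ0 n).ne']
  refine exists_congr fun B => forall_congr' fun n => ?_
  rw [div_le_iff₀ (pow_pos hγ0 n), Real.norm_of_nonneg (pow_pos hγ0 n).le]

theorem ConvergesGeometrically.tendsto (hf : ConvergesGeometrically f l β) :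
    Tendsto f atTop (𝓝 l) := by
  obtain ⟨hβ, hβ1, hO⟩ := convergesGeometrically_iff_isBigO.1 hf
  obtain ⟨γ, hγ, hγ1⟩ := exists_between hβ1
  exact tendsto_sub_nhds_zero_iff.1 <|
    (hO γ hγ hγ1).trans_tendsto (tendsto_pow_atTop_nhds_zero_of_lt_one (hβ.trans hγ.le) hγ1)

theorem convergesGeometrically_iff_forall_residue {h : ℕ} (hh : h ≠ 0) (hβ : 0 ≤ β) :
    ConvergesGeometrically f l β ↔
      ∀ i : Fin h, ConvergesGeometrically (fun n => f (h * n + i)) l (β ^ h) := by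
  have : NeZero h := ⟨hh⟩
  simp only [convergesGeometrically_iff_isBigO, forall_and, forall_const, hβ, pow_nonneg,
    pow_lt_one_iff_of_nonneg hβ hh, true_and]
  refine and_congr_right fun _ => ?_
  have hresidues : ∀ γ, β < γ → ((fun n => f n - l) =O[atTop] (fun n => γ ^ n) ↔
      ∀ i : Fin h, (fun n : ℕ => f (h * n + i) - l) =O[atTop] fun n => (γ ^ h) ^ n) := by
    intro γ hγ
    rw [isBigO_atTop_iff_forall_residue hh]
    exact forall_congr' fun i => (isTheta_pow_mul_add (hβ.trans_lt hγ).ne' h i).isBigO_congr_right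
  constructor
  · intro hf i γ hγ hγ1
    have hγ0 : 0 ≤ γ := (pow_nonneg hβ h).trans hγ.le
    have hroot : (γ ^ (h : ℝ)⁻¹) ^ h = γ := Real.rpow_inv_natCast_pow hγ0 hh
    have hroot0 : 0 ≤ γ ^ (h : ℝ)⁻¹ := Real.rpow_nonneg hγ0 _
    rw [← hroot] at hγ hγ1 ⊢
    have hβγ := lt_of_pow_lt_pow_left₀ h hroot0 hγ
    exact (hresidues _ hβγ).1 (hf _ hβγ ((pow_lt_one_iff_of_nonneg hroot0 hh).1 hγ1)) i
  · intro hf γ hγ hγ1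
    have hγ0 : 0 ≤ γ := hβ.trans hγ.le
    exact (hresidues γ hγ).2 fun i =>
      hf i _ (pow_lt_pow_left₀ hγ hβ hh) (pow_lt_one₀ hγ0 hγ1 hh)

theorem convergesGeometrically_div_one_of_sub {x s : ℕ → ℝ} {c : ℝ} (hc : 0 < c)
    (hx : ∀ n, c ≤ x n) (hxs : ConvergesGeometrically (x - s) 0 β) :
    ConvergesGeometrically (x / s) 1 β := by
  obtain ⟨hβ, hβ1, hO⟩ := convergesGeometrically_iff_isBigO.1 hxs
  have hs : ∀ᶠ n in atTop, c / 2 ≤ s n := by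
    filter_upwards [hxs.tendsto.eventually (gt_mem_nhds (half_pos hc))] with n hn
    have hn' : x n - s n < c / 2 := hn
    linarith [hx n]
  have hs_inv : (fun n => (s n)⁻¹) =O[atTop] fun _ => (1 : ℝ) := by
    refine IsBigO.of_bound (c / 2)⁻¹ ?_
    filter_upwards [hs] with n hn
    have hsn : 0 < s n := (half_pos hc).trans_le hn
    rw [Real.norm_of_nonneg (inv_pos.2 hsn).le, norm_one, mul_one]
    exact inv_anti₀ (half_pos hc) hn
  refine convergesGeometrically_iff_isBigO.2 ⟨hβ, hβ1, fun γ hγ hγ1 => ?_⟩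
  refine (((hO γ hγ hγ1).mul hs_inv).congr' ?_ (by simp))
  filter_upwards [hs] with n hn
  have hsn : s n ≠ 0 := ((half_pos hc).trans_le hn).ne'
  simp only [Pi.sub_apply, Pi.div_apply]
  field_simp
  ring

theorem ConvergesGeometrically.isEquivalent {u v : ℕ → ℂ}
    (huv : ConvergesGeometrically (u / v) 1 β) : u ~[atTop] v :=
  isEquivalent_of_tendsto_one huv.tendsto

theorem ConvergesGeometrically.ofReal {x : ℕ → ℝ} {y : ℝ} (hx : ConvergesGeometrically x y β) :
    ConvergesGeometrically (fun n => (x n : ℂ)) y β := by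
  simpa only [ConvergesGeometrically, ← Complex.ofReal_sub, Complex.norm_real] using hx

theorem tendsto_rpow_one_div_of_isBigO_pow {b : ℕ → ℝ} {c r : ℝ} (hc : 0 < c) (hr : 0 ≤ r)
    (hlower : ∀ n, c * r ^ n ≤ b n) (hupper : ∀ γ, r < γ → b =O[atTop] fun n => γ ^ n) :
    Tendsto (fun n : ℕ => b n ^ (1 / n : ℝ)) atTop (𝓝 r) := by
  have hroot : ∀ {C : ℝ}, 0 < C → ∀ γ : ℝ,
      Tendsto (fun n : ℕ => C ^ (1 / n : ℝ) * γ) atTop (𝓝 γ) := fun {C} hC γ => by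
    simpa using (((Real.continuous_const_rpow hC.ne').tendsto 0).comp
      tendsto_one_div_atTop_nhds_zero_nat).mul_const γ
  have hroot_eq : ∀ {C γ : ℝ}, 0 < C → 0 ≤ γ → ∀ {n : ℕ}, n ≠ 0 →
      (C * γ ^ n) ^ (1 / n : ℝ) = C ^ (1 / n : ℝ) * γ := fun hC hγ n hn => by
    rw [Real.mul_rpow hC.le (pow_nonneg hγ n), one_div, Real.pow_rpow_inv_natCast hγ hn]
  have hb0 : ∀ n, 0 ≤ b n := fun n => (by positivity : 0 ≤ c * r ^ n).trans (hlower n)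
  refine tendsto_order.2 ⟨fun a ha => ?_, fun a ha => ?_⟩
  · filter_upwards [(hroot hc r).eventually (lt_mem_nhds ha), eventually_ne_atTop 0] with n hn hn0
    rw [← hroot_eq hc hr hn0] at hn
    exact hn.trans_le (Real.rpow_le_rpow (by positivity) (hlower n) (by positivity))
  · obtain ⟨γ, hrγ, hγa⟩ := exists_between ha
    have hγ0 : 0 ≤ γ := hr.trans hrγ.le
    obtain ⟨C, hC, hbC⟩ := (hupper γ hrγ).exists_pos
    filter_upwards [hbC.bound, (hroot hC γ).eventually (gt_mem_nhds hγa),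
      eventually_ne_atTop 0] with n hbn hn hn0
    rw [← hroot_eq hC hγ0 hn0] at hn
    rw [Real.norm_of_nonneg (hb0 n), Real.norm_of_nonneg (pow_nonneg hγ0 n)] at hbn
    exact (Real.rpow_le_rpow (hb0 n) hbn (by positivity)).trans_lt hn

end GeometricConvergence

section PowerGrowth

theorem isBigO_pow_of_spectralRadius_lt {A : Type*} [NormedRing A] [NormedAlgebra ℂ A]
    [CompleteSpace A] {a : A} {γ : ℝ} (ha : spectralRadius ℂ a < ENNReal.ofReal γ) :
    (fun n : ℕ => a ^ n) =O[atTop] fun n => γ ^ n := by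
  have hγ : 0 < γ := ENNReal.ofReal_pos.1 (bot_le.trans_lt ha)
  refine IsBigO.of_bound 1 ?_
  have hlim := spectrum.pow_nnnorm_pow_one_div_tendsto_nhds_spectralRadius a
  filter_upwards [hlim.eventually_lt_const ha, eventually_ne_atTop 0] with n hn hn0
  rw [one_div, ENNReal.rpow_inv_lt_iff (by positivity), ENNReal.rpow_natCast,
    ← ENNReal.ofReal_pow hγ.le, ← enorm_eq_nnnorm, ← ofReal_norm,
    ENNReal.ofReal_lt_ofReal_iff (by positivity)] at hn
  rw [one_mul, Real.norm_of_nonneg (by positivity)]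
  exact hn.le

end PowerGrowth

section Spectrum

variable {m : Type*} [Fintype m] [DecidableEq m]

theorem mem_eigs_iff_mem_spectrum (M : Matrix m m ℝ) (μ : ℂ) :
    μ ∈ eigs M ↔ μ ∈ spectrum ℂ (M.map Complex.ofReal) := by
  rw [eigs, Polynomial.mem_roots (Matrix.charpoly_monic _).ne_zero,
    Matrix.mem_spectrum_iff_isRoot_charpoly]

theorem mem_eigs_iff_exists_mulVec_eq_smul (M : Matrix m m ℝ) (μ : ℂ) :
    μ ∈ eigs M ↔ ∃ v : m → ℂ, v ≠ 0 ∧ M.map Complex.ofReal *ᵥ v = μ • v := by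
  rw [mem_eigs_iff_mem_spectrum, ← Matrix.spectrum_toLin',
    ← Module.End.hasEigenvalue_iff_mem_spectrum]
  constructor
  · intro hμ
    obtain ⟨v, hv⟩ := hμ.exists_hasEigenvector
    exact ⟨v, hv.2, by simpa only [Matrix.toLin'_apply] using hv.apply_eq_smul⟩
  · rintro ⟨v, hv, hMv⟩
    exact Module.End.hasEigenvalue_of_hasEigenvector
      ⟨Module.End.mem_eigenspace_iff.2 (by simpa only [Matrix.toLin'_apply] using hMv), hv⟩

theorem exists_mem_eigs [Nonempty m] (M : Matrix m m ℝ) : ∃ μ, μ ∈ eigs M := by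
  obtain ⟨μ, hμ⟩ := spectrum.nonempty_of_isAlgClosed_of_finiteDimensional ℂ (M.map Complex.ofReal)
  exact ⟨μ, (mem_eigs_iff_mem_spectrum M μ).2 hμ⟩

theorem map_ofReal_pow (M : Matrix m m ℝ) (n : ℕ) :
    (M ^ n).map Complex.ofReal = M.map Complex.ofReal ^ n :=
  map_pow (Complex.ofRealHom.mapMatrix (m := m)) M n

theorem pow_mem_eigs_pow {M : Matrix m m ℝ} {μ : ℂ} (hμ : μ ∈ eigs M) (n : ℕ) :
    μ ^ n ∈ eigs (M ^ n) := by
  rw [mem_eigs_iff_mem_spectrum] at hμ ⊢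
  rw [map_ofReal_pow]
  exact spectrum.pow_mem_pow _ n hμ

theorem roots_charpoly_smul {K : Type*} [Field K] (A : Matrix m m K) {z : K} (hz : z ≠ 0) :
    (z • A).charpoly.roots = A.charpoly.roots.map (z * ·) := by
  have hcomp : (z • A).charpoly.comp (Polynomial.C z * Polynomial.X + Polynomial.C 0) =
      Polynomial.C (z ^ Fintype.card m) * A.charpoly := by
    rw [Polynomial.C_0, add_zero, Matrix.charpoly, Matrix.charpoly,
      ← Polynomial.coe_compRingHom_apply, RingHom.map_det, Polynomial.C_pow, ← Matrix.det_smul]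
    congr 1
    ext i j : 1
    obtain rfl | hij := eq_or_ne i j
    · simp [Matrix.charmatrix_apply_eq, mul_sub]
    · simp [Matrix.charmatrix_apply_ne _ _ _ hij]
  rw [← Polynomial.map_roots_comp_C_mul_X_add_C (z • A).charpoly z 0 (isUnit_iff_ne_zero.2 hz),
    hcomp, Polynomial.roots_C_mul _ (pow_ne_zero _ hz)]
  simp only [add_zero]

theorem eigs_smul (M : Matrix m m ℝ) {c : ℝ} (hc : c ≠ 0) :
    eigs (c • M) = (eigs M).map ((c : ℂ) * ·) := by
  have hmap : (c • M).map Complex.ofReal = (c : ℂ) • M.map Complex.ofReal := by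
    ext i j
    simp
  rw [eigs, hmap, roots_charpoly_smul _ (Complex.ofReal_ne_zero.2 hc), ← eigs]

attribute [local instance] Matrix.linftyOpNormedRing Matrix.linftyOpNormedAlgebra in
theorem isBigO_pow_apply {M : Matrix m m ℝ} {γ : ℝ} (hM : ∀ μ ∈ eigs M, ‖μ‖ < γ) (i j : m) :
    (fun n : ℕ => (M ^ n) i j) =O[atTop] fun n => γ ^ n := by
  have : Nonempty m := ⟨i⟩
  have hrad : spectralRadius ℂ (M.map Complex.ofReal) < ENNReal.ofReal γ :=
    spectrum.spectralRadius_lt_of_forall_lt _ fun μ hμ => by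
      rw [← NNReal.coe_lt_coe, coe_nnnorm, Real.coe_toNNReal']
      exact (hM μ ((mem_eigs_iff_mem_spectrum M μ).2 hμ)).trans_le (le_max_left γ 0)
  have hentry := (Matrix.entryLinearMap ℂ ℂ i j).toContinuousLinearMap.isBigO_comp
    (fun n : ℕ => M.map Complex.ofReal ^ n) atTop
  refine .of_norm_left <| (hentry.trans (isBigO_pow_of_spectralRadius_lt hrad)).norm_left.congr_left
    fun n => ?_
  rw [← map_ofReal_pow]
  exact Complex.norm_real _

theorem norm_le_sum_of_mem_eigs {M : Matrix m m ℝ} {μ : ℂ} (hμ : μ ∈ eigs M) :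
    ‖μ‖ ≤ ∑ i, ∑ j, |M i j| := by
  rw [mem_eigs_iff_mem_spectrum, ← Matrix.spectrum_toLin',
    ← Module.End.hasEigenvalue_iff_mem_spectrum] at hμ
  obtain ⟨k, hk⟩ := eigenvalue_mem_ball hμ
  have hk' := norm_le_of_mem_closedBall hk
  rw [add_comm, Finset.sum_erase_add _ _ (Finset.mem_univ k)] at hk'
  calc ‖μ‖ ≤ ∑ j, |M k j| := by simpa using hk'
    _ ≤ ∑ i, ∑ j, |M i j| := Finset.single_le_sum (f := fun i => ∑ j, |M i j|)
        (fun i _ => Finset.sum_nonneg fun j _ => abs_nonneg _) (Finset.mem_univ k)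

theorem norm_pow_le_sum_pow_apply {M : Matrix m m ℝ} (hM : ∀ i j, 0 ≤ M i j) {μ : ℂ}
    (hμ : μ ∈ eigs M) (n : ℕ) : ‖μ‖ ^ n ≤ ∑ i, ∑ j, (M ^ n) i j := by
  rw [← norm_pow]
  simpa only [abs_of_nonneg (Matrix.pow_apply_nonneg hM n _ _)] using
    norm_le_sum_of_mem_eigs (pow_mem_eigs_pow hμ n)

theorem pow_card_eq_zero_of_forall_mem_eigs {M : Matrix m m ℝ} (hM : ∀ μ ∈ eigs M, μ = 0) :
    M ^ Fintype.card m = 0 := by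
  have hsplits := IsAlgClosed.splits (M.map Complex.ofReal).charpoly
  have hcharpoly : (M.map Complex.ofReal).charpoly = Polynomial.X ^ Fintype.card m := by
    rw [hsplits.eq_prod_roots_of_monic (Matrix.charpoly_monic _), ← eigs,
      Multiset.eq_replicate_card.2 hM, eigs, ← hsplits.natDegree_eq_card_roots,
      Matrix.charpoly_natDegree_eq_dim]
    simp
  have hpow := Matrix.aeval_self_charpoly (M.map Complex.ofReal)
  rw [hcharpoly, map_pow, Polynomial.aeval_X, ← map_ofReal_pow] at hpow
  exact Matrix.map_injective Complex.ofReal_injective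
    (hpow.trans (Matrix.map_zero _ Complex.ofReal_zero).symm)

end Spectrum

section Subinvariance

theorem exists_lt_smul_le_of_smul_lt {m : Type*} [Finite m] [Nonempty m] {x y : m → ℝ} {r : ℝ}
    (hx : ∀ i, 0 < x i) (hxy : ∀ i, r * x i < y i) : ∃ c, r < c ∧ c • x ≤ y := by
  obtain ⟨i, hi⟩ := Finite.exists_min fun i => y i / x i
  exact ⟨y i / x i, (lt_div_iff₀ (hx i)).2 (hxy i), fun j => (le_div_iff₀ (hx j)).1 (hi j)⟩

variable {m : Type*} [Fintype m]

theorem mulVec_mono_of_nonneg {M : Matrix m m ℝ} (hM : ∀ i j, 0 ≤ M i j) {v w : m → ℝ}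
    (hvw : v ≤ w) : M *ᵥ v ≤ M *ᵥ w := fun i =>
  Finset.sum_le_sum fun j _ => mul_le_mul_of_nonneg_left (hvw j) (hM i j)

theorem mulVec_pos_of_pos {Q : Matrix m m ℝ} (hQ : ∀ i j, 0 < Q i j) {x : m → ℝ} (hx : 0 ≤ x)
    (hx0 : x ≠ 0) (i : m) : 0 < (Q *ᵥ x) i := by
  obtain ⟨j, hj⟩ := Function.ne_iff.1 hx0
  exact Finset.sum_pos' (fun k _ => mul_nonneg (hQ i k).le (hx k))
    ⟨j, Finset.mem_univ j, mul_pos (hQ i j) ((hx j).lt_of_ne' hj)⟩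

theorem exists_pos_commute_of_isIrreducible {M : Matrix m m ℝ} (hM : M.IsIrreducible) :
    ∃ Q : Matrix m m ℝ, Commute Q M ∧ ∀ i j, 0 < Q i j := by
  classical
  choose k _ hk using (Matrix.isIrreducible_iff_exists_pow_pos hM.nonneg).1 hM
  refine ⟨∑ p : m × m, M ^ k p.1 p.2, Commute.sum_left _ _ _ fun p _ => Commute.pow_self M _,
    fun i j => ?_⟩
  rw [Matrix.sum_apply]
  exact Finset.sum_pos' (fun p _ => Matrix.pow_apply_nonneg hM.nonneg _ i j)
    ⟨(i, j), Finset.mem_univ _, hk i j⟩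

theorem pos_of_mulVec_eq_smul {M : Matrix m m ℝ} (hM : M.IsIrreducible) {r : ℝ} (hr : 0 ≤ r)
    {y : m → ℝ} (hy : 0 ≤ y) (hy0 : y ≠ 0) (hMy : M *ᵥ y = r • y) (i : m) : 0 < y i := by
  classical
  obtain ⟨j, hj⟩ := Function.ne_iff.1 hy0
  obtain ⟨k, -, hk⟩ := (Matrix.isIrreducible_iff_exists_pow_pos hM.nonneg).1 hM i j
  have hpow : ∀ n, M ^ n *ᵥ y = r ^ n • y := fun n => by
    induction n with
    | zero => simp
    | succ n ih =>
      rw [pow_succ, ← Matrix.mulVec_mulVec, hMy, Matrix.mulVec_smul, ih, smul_smul, pow_succ']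
  have hpos : 0 < (M ^ k *ᵥ y) i :=
    Finset.sum_pos' (fun l _ => mul_nonneg (Matrix.pow_apply_nonneg hM.nonneg k i l) (hy l))
      ⟨j, Finset.mem_univ j, mul_pos hk ((hy j).lt_of_ne' hj)⟩
  rw [hpow] at hpos
  exact pos_of_mul_pos_right hpos (pow_nonneg hr k)

variable [DecidableEq m]

theorem pow_smul_le_pow_mulVec {M : Matrix m m ℝ} (hM : ∀ i j, 0 ≤ M i j) {c : ℝ} (hc : 0 ≤ c)
    {x : m → ℝ} (hx : c • x ≤ M *ᵥ x) (n : ℕ) : c ^ n • x ≤ M ^ n *ᵥ x := by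
  induction n with
  | zero => simp
  | succ n ih =>
    calc c ^ (n + 1) • x = c ^ n • (c • x) := by rw [smul_smul, pow_succ]
      _ ≤ c ^ n • (M *ᵥ x) := smul_le_smul_of_nonneg_left hx (by positivity)
      _ = M *ᵥ (c ^ n • x) := (Matrix.mulVec_smul _ _ _).symm
      _ ≤ M *ᵥ (M ^ n *ᵥ x) := mulVec_mono_of_nonneg hM ih
      _ = M ^ (n + 1) *ᵥ x := by rw [Matrix.mulVec_mulVec, pow_succ']

theorem le_of_smul_le_mulVec {M : Matrix m m ℝ} (hM : ∀ i j, 0 ≤ M i j) {r c : ℝ} (hr : 0 ≤ r)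
    (hspec : ∀ μ ∈ eigs M, ‖μ‖ ≤ r) {x : m → ℝ} (hx : 0 ≤ x) (hx0 : x ≠ 0)
    (hcx : c • x ≤ M *ᵥ x) : c ≤ r := by
  by_contra! hrc
  obtain ⟨γ, hrγ, hγc⟩ := exists_between hrc
  have hγ : 0 ≤ γ := hr.trans hrγ.le
  have hc : 0 ≤ c := hγ.trans hγc.le
  obtain ⟨i, hi⟩ := Function.ne_iff.1 hx0
  have hxi : 0 < x i := (hx i).lt_of_ne' hi
  have hlower : (fun n : ℕ => c ^ n) =O[atTop] fun n => (M ^ n *ᵥ x) i := by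
    refine IsBigO.of_bound (x i)⁻¹ (Eventually.of_forall fun n => ?_)
    rw [Real.norm_of_nonneg (pow_nonneg hc n), inv_mul_eq_div, le_div_iff₀ hxi]
    exact (pow_smul_le_pow_mulVec hM hc hcx n i).trans (Real.le_norm_self _)
  have hupper : (fun n : ℕ => (M ^ n *ᵥ x) i) =O[atTop] fun n => γ ^ n :=
    IsBigO.fun_sum fun j _ => by
      simpa only [mul_comm] using
        (isBigO_pow_apply (fun μ hμ => (hspec μ hμ).trans_lt hrγ) i j).const_mul_left (x j)
  have hlt : (fun n : ℕ => c ^ n) =o[atTop] fun n => c ^ n :=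
    (hlower.trans hupper).trans_isLittleO (isLittleO_pow_pow_of_lt_left hγ hγc)
  exact isLittleO_irrefl (Frequently.of_forall fun n => pow_ne_zero n (hγ.trans_lt hγc).ne') hlt

theorem mulVec_eq_smul_of_isIrreducible {M : Matrix m m ℝ} (hM : M.IsIrreducible) {r : ℝ}
    (hr : 0 ≤ r) (hspec : ∀ μ ∈ eigs M, ‖μ‖ ≤ r) {y : m → ℝ} (hy : 0 ≤ y) (hy0 : y ≠ 0)
    (hry : r • y ≤ M *ᵥ y) : M *ᵥ y = r • y := by
  by_contra hne
  obtain ⟨i, -⟩ := Function.ne_iff.1 hy0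
  have : Nonempty m := ⟨i⟩
  obtain ⟨Q, hQM, hQ⟩ := exists_pos_commute_of_isIrreducible hM
  have hx : ∀ i, 0 < (Q *ᵥ y) i := mulVec_pos_of_pos hQ hy hy0
  have hgap : ∀ i, r * (Q *ᵥ y) i < (M *ᵥ (Q *ᵥ y)) i := fun i => by
    have hpos := mulVec_pos_of_pos hQ (sub_nonneg.2 hry) (sub_ne_zero.2 hne) i
    rw [Matrix.mulVec_sub, Matrix.mulVec_mulVec, hQM.eq, ← Matrix.mulVec_mulVec,
      Matrix.mulVec_smul] at hpos
    exact sub_pos.1 hpos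
  obtain ⟨c, hrc, hc⟩ := exists_lt_smul_le_of_smul_lt hx hgap
  exact hrc.not_ge <| le_of_smul_le_mulVec hM.nonneg hr hspec (fun i => (hx i).le)
    (fun h0 => (hx i).ne' (congrFun h0 i)) hc

end Subinvariance

section Rotation

open RealInnerProductSpace in
theorem eq_of_sum_smul_eq_sum_smul {E κ : Type*} [NormedAddCommGroup E] [InnerProductSpace ℝ E]
    [Fintype κ] {p : κ → ℝ} (hp : ∀ j, 0 ≤ p j) {u : κ → E} (hu : ∀ j, ‖u j‖ = 1) {w : E}
    (hw : ‖w‖ = 1) (h : ∑ j, p j • u j = (∑ j, p j) • w) {j : κ} (hj : p j ≠ 0) : u j = w := by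
  have hinner : ∀ j, ⟪u j, w⟫ ≤ 1 := fun j => by
    simpa only [hu, hw, one_mul] using real_inner_le_norm (u j) w
  have hdefect : ∑ j, p j * (1 - ⟪u j, w⟫) = 0 := by
    have hsum := congrArg (⟪·, w⟫) h
    simp only [sum_inner, real_inner_smul_left, real_inner_self_eq_norm_sq, hw, one_pow,
      mul_one] at hsum
    simp only [mul_sub, mul_one, Finset.sum_sub_distrib, hsum, sub_self]
  have hzero := (Finset.sum_eq_zero_iff_of_nonneg fun j _ =>
    mul_nonneg (hp j) (sub_nonneg.2 (hinner j))).1 hdefect j (Finset.mem_univ j)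
  exact (inner_eq_one_iff_of_norm_eq_one (hu j) hw).1
    (sub_eq_zero.1 ((mul_eq_zero.1 hzero).resolve_left hj)).symm

variable {m : Type*} [Fintype m]

theorem norm_smul_le_mulVec_norm {M : Matrix m m ℝ} (hM : ∀ i j, 0 ≤ M i j) {μ : ℂ} {v : m → ℂ}
    (hv : M.map Complex.ofReal *ᵥ v = μ • v) :
    ‖μ‖ • (fun i => ‖v i‖) ≤ M *ᵥ fun i => ‖v i‖ := fun i => by
  calc ‖μ‖ * ‖v i‖ = ‖∑ j, (M i j : ℂ) * v j‖ := by
        rw [← norm_mul, ← smul_eq_mul, ← Pi.smul_apply, ← hv]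
        rfl
    _ ≤ ∑ j, ‖(M i j : ℂ) * v j‖ := norm_sum_le _ _
    _ = ∑ j, M i j * ‖v j‖ := Finset.sum_congr rfl fun j _ => by
        rw [norm_mul, Complex.norm_of_nonneg (hM i j)]

variable [DecidableEq m]

/-- Conjugation by the diagonal matrix of `u` multiplies `A` by `z`. -/
theorem roots_charpoly_map_mul_of_edge {K : Type*} [Field K] {A : Matrix m m K} {z : K}
    (hz : z ≠ 0) {u : m → K} (hu : ∀ i, u i ≠ 0) (hedge : ∀ i j, A i j ≠ 0 → u j = z * u i) :
    A.charpoly.roots.map (z * ·) = A.charpoly.roots := by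
  have hunit : IsUnit (Matrix.diagonal u) := by
    rw [Matrix.isUnit_iff_isUnit_det, Matrix.det_diagonal, isUnit_iff_ne_zero,
      Finset.prod_ne_zero_iff]
    exact fun i _ => hu i
  obtain ⟨U, hU⟩ := hunit
  have hAU : A * U.val = U.val * (z • A) := by
    rw [hU]
    ext i j
    rw [Matrix.mul_diagonal, Matrix.diagonal_mul, Matrix.smul_apply, smul_eq_mul]
    by_cases hij : A i j = 0
    · simp only [hij, zero_mul, mul_zero]
    · rw [hedge i j hij]
      ring
  have hconj : U⁻¹.val * A * U.val = z • A := by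
    rw [mul_assoc, hAU, ← mul_assoc, Units.inv_mul, one_mul]
  rw [← roots_charpoly_smul A hz, ← hconj, Matrix.coe_units_inv, Matrix.charpoly_units_conj']

theorem exists_norm_eq_one_edge_of_mul_mem_eigs {M : Matrix m m ℝ} (hM : M.IsIrreducible) {r : ℝ}
    (hr : 0 ≤ r) (hspec : ∀ μ ∈ eigs M, ‖μ‖ ≤ r) {z : ℂ} (hz : ‖z‖ = 1) (hzr : z * r ∈ eigs M) :
    ∃ u : m → ℂ, (∀ i, ‖u i‖ = 1) ∧ ∀ i j, M i j ≠ 0 → u j = z * u i := by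
  obtain ⟨v, hv0, hv⟩ := (mem_eigs_iff_exists_mulVec_eq_smul M _).1 hzr
  have hv_apply : ∀ i, ∑ j, (M i j : ℂ) * v j = z * r * v i := fun i => congrFun hv i
  set x : m → ℝ := fun i => ‖v i‖
  have hx_nonneg : 0 ≤ x := fun i => norm_nonneg (v i)
  have hx0 : x ≠ 0 := fun h => hv0 (funext fun i => norm_eq_zero.1 (congrFun h i))
  have hsub : r • x ≤ M *ᵥ x := by
    simpa only [norm_mul, hz, one_mul, Complex.norm_of_nonneg hr] using
      norm_smul_le_mulVec_norm hM.nonneg hv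
  have heq := mulVec_eq_smul_of_isIrreducible hM hr hspec hx_nonneg hx0 hsub
  have hx_pos := pos_of_mulVec_eq_smul hM hr hx_nonneg hx0 heq
  have hu : ∀ i, ‖v i / x i‖ = 1 := fun i => by
    rw [norm_div, Complex.norm_of_nonneg (hx_nonneg i)]
    exact div_self (hx_pos i).ne'
  have hvx : ∀ i, (x i : ℂ) * (v i / x i) = v i := fun i =>
    mul_div_cancel₀ _ (Complex.ofReal_ne_zero.2 (hx_pos i).ne')
  refine ⟨fun i => v i / x i, hu, fun i j hij => ?_⟩
  refine eq_of_sum_smul_eq_sum_smul (p := fun j => M i j * x j)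
    (fun j => mul_nonneg (hM.nonneg i j) (hx_nonneg j)) hu (by rw [norm_mul, hz, hu, one_mul]) ?_
    (mul_ne_zero hij (hx_pos j).ne')
  have hsum : ∑ j, M i j * x j = r * x i := congrFun heq i
  rw [hsum, Complex.real_smul]
  calc ∑ j, (M i j * x j) • (v j / x j) = ∑ j, (M i j : ℂ) * v j :=
        Finset.sum_congr rfl fun j _ => by
          rw [Complex.real_smul, Complex.ofReal_mul, mul_assoc, hvx]
    _ = z * r * (x i * (v i / x i)) := by rw [hvx, ← hv_apply]
    _ = ((r * x i : ℝ) : ℂ) * (z * (v i / x i)) := by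
        push_cast
        ring

theorem eigs_map_mul_of_isIrreducible {M : Matrix m m ℝ} (hM : M.IsIrreducible) {r : ℝ}
    (hr : 0 ≤ r) (hspec : ∀ μ ∈ eigs M, ‖μ‖ ≤ r) {z : ℂ} (hz : ‖z‖ = 1) (hzr : z * r ∈ eigs M) :
    (eigs M).map (z * ·) = eigs M := by
  obtain ⟨u, hu, hedge⟩ := exists_norm_eq_one_edge_of_mul_mem_eigs hM hr hspec hz hzr
  refine roots_charpoly_map_mul_of_edge (norm_ne_zero_iff.1 (hz.symm ▸ one_ne_zero))
    (fun i => norm_ne_zero_iff.1 (hu i ▸ one_ne_zero)) fun i j hij => hedge i j ?_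
  exact Complex.ofReal_ne_zero.1 hij

end Rotation

section Periods

theorem eq_nthRootsFinset_card_of_mul_mem {R : Type*} [CommRing R] [IsDomain R] {G : Finset R}
    (hne : G.Nonempty) (h0 : 0 ∉ G) (hmul : ∀ x ∈ G, ∀ y ∈ G, x * y ∈ G) :
    G = Polynomial.nthRootsFinset G.card (1 : R) := by
  classical
  have hpow : ∀ g ∈ G, g ^ G.card = 1 := by
    intro g hg
    have hinj : Function.Injective (g * ·) := mul_right_injective₀ (ne_of_mem_of_not_mem hg h0)
    have himage : G.image (g * ·) = G :=
      Finset.eq_of_subset_of_card_le (Finset.image_subset_iff.2 (hmul g hg))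
        (Finset.card_image_of_injective G hinj).ge
    have hprod : g ^ G.card * ∏ x ∈ G, x = ∏ x ∈ G, x := by
      conv_rhs => rw [← himage, Finset.prod_image hinj.injOn, Finset.prod_mul_distrib,
        Finset.prod_const]
    exact (mul_eq_right₀ (Finset.prod_ne_zero_iff.2 fun x hx => ne_of_mem_of_not_mem hx h0)).1 hprod
  refine Finset.eq_of_subset_of_card_le
    (fun g hg => (Polynomial.mem_nthRootsFinset hne.card_pos 1).2 (hpow g hg)) ?_
  rw [Polynomial.nthRootsFinset_def]
  exact (Multiset.toFinset_card_le _).trans (Polynomial.card_nthRoots _ _)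

theorem map_range_exp_mul_eq_nthRoots {h : ℕ} (hh : h ≠ 0) (r : ℂ) :
    ((Multiset.range h).map fun k : ℕ => Complex.exp (k * (2 * Real.pi * Complex.I / h)) * r) =
      Polynomial.nthRoots h (r ^ h) := by
  simp_rw [Complex.exp_nat_mul]
  exact ((Complex.isPrimitiveRoot_exp h hh).nthRoots_eq rfl).symm

theorem isPeriods_iff_bind_nthRoots {m : Type*} [Fintype m] [DecidableEq m] {M : Matrix m m ℝ}
    {r : ℝ} {hs : Multiset ℕ} :
    IsPeriods M r hs ↔ Multiset.card hs = (eigs M).count (r : ℂ) ∧ 0 ∉ hs ∧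
      (eigs M).filter (‖·‖ = r) = hs.bind fun h => Polynomial.nthRoots h ((r : ℂ) ^ h) := by
  have hpos : (∀ h ∈ hs, 1 ≤ h) ↔ 0 ∉ hs :=
    ⟨fun h1 h0 => absurd (h1 0 h0) (by simp), fun h0 h hh =>
      Nat.one_le_iff_ne_zero.2 (ne_of_mem_of_not_mem hh h0)⟩
  unfold IsPeriods
  rw [hpos]
  refine Iff.and (by congr!) (and_congr_right fun h0 => ?_)
  have hfamilies : (hs.bind fun h => (Multiset.range h).map fun k =>
      Complex.exp (k * (2 * Real.pi * Complex.I / h)) * (r : ℂ)) =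
      hs.bind fun h => Polynomial.nthRoots h ((r : ℂ) ^ h) :=
    Multiset.bind_congr fun h hh => by
      rw [← map_range_exp_mul_eq_nthRoots (ne_of_mem_of_not_mem hh h0)]
      simp [Multiset.bind_def, Multiset.pure_def, Multiset.bind_singleton, Multiset.map_map]
  rw [hfamilies]

theorem count_nthRoots_pow_self {h : ℕ} (hh : h ≠ 0) {r : ℂ} (hr : r ≠ 0) :
    (Polynomial.nthRoots h (r ^ h)).count r = 1 :=
  Multiset.count_eq_one_of_mem
    ((Complex.isPrimitiveRoot_exp h hh).nthRoots_nodup (pow_ne_zero h hr))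
    ((Polynomial.mem_nthRoots (Nat.pos_of_ne_zero hh)).2 rfl)

theorem exists_eq_nsmul_nthRoots_of_map_mul {F : Multiset ℂ} {r : ℂ} (hF : F ≠ 0) (h0 : 0 ∉ F)
    (hr : r ≠ 0) (hrot : ∀ μ ∈ F, F.map (μ / r * ·) = F) :
    ∃ h : ℕ, h ≠ 0 ∧ ∃ k : ℕ, F = k • Polynomial.nthRoots h (r ^ h) := by
  set G := F.toFinset.image (· / r) with hG
  have hinj : Function.Injective (· / r) := fun _ _ => (div_left_inj' hr).1
  have hmem : ∀ μ, μ / r ∈ G ↔ μ ∈ F := fun μ => by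
    rw [hG, hinj.mem_finset_image, Multiset.mem_toFinset]
  have hne : G.Nonempty := (Multiset.toFinset_nonempty.2 hF).image _
  have hh : G.card ≠ 0 := hne.card_pos.ne'
  have hroots : G = Polynomial.nthRootsFinset G.card (1 : ℂ) := by
    refine eq_nthRootsFinset_card_of_mul_mem hne ?_ ?_
    · rw [← zero_div r, hmem]
      exact h0
    · simp only [hG, Finset.forall_mem_image, Multiset.mem_toFinset]
      intro μ hμ ν hν
      rw [← mul_div_assoc, ← hG, hmem, ← hrot μ hμ]
      exact Multiset.mem_map_of_mem _ hν
  have hmem_roots : ∀ μ, μ ∈ Polynomial.nthRoots G.card (r ^ G.card) ↔ μ ∈ F := fun μ => by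
    rw [← hmem, Polynomial.mem_nthRoots hne.card_pos, ← div_eq_one_iff_eq (pow_ne_zero _ hr),
      ← div_pow, ← Polynomial.mem_nthRootsFinset hne.card_pos, ← hroots]
  refine ⟨G.card, hh, F.count r, Multiset.ext.2 fun μ => ?_⟩
  rw [Multiset.count_nsmul]
  by_cases hμ : μ ∈ F
  · have hμ0 : μ / r ≠ 0 := div_ne_zero (ne_of_mem_of_not_mem hμ h0) hr
    rw [Multiset.count_eq_one_of_mem ((Complex.isPrimitiveRoot_exp _ hh).nthRoots_nodup
      (pow_ne_zero _ hr)) ((hmem_roots μ).2 hμ), mul_one]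
    calc F.count μ = (F.map (μ / r * ·)).count (μ / r * r) := by
          rw [hrot μ hμ, div_mul_cancel₀ μ hr]
      _ = F.count r := Multiset.count_map_eq_count' _ _ (mul_right_injective₀ hμ0) r
  · rw [Multiset.count_eq_zero.2 hμ, Multiset.count_eq_zero.2 (mt (hmem_roots μ).1 hμ), mul_zero]

end Periods

section PeripheralSpectrum

theorem exists_invariant_of_not_isIrreducible {m : Type*} [Finite m] [Nontrivial m]
    {M : Matrix m m ℝ} (hM : ∀ i j, 0 ≤ M i j) (hirr : ¬M.IsIrreducible) :
    ∃ s : Set m, s.Nonempty ∧ s ≠ Set.univ ∧ ∀ i ∈ s, ∀ j ∉ s, M i j = 0 := by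
  classical
  have := Fintype.ofFinite m
  simp only [Matrix.isIrreducible_iff_exists_pow_pos hM, not_forall] at hirr
  obtain ⟨i, j, hij⟩ := hirr
  set s := {l | ∃ k > 0, 0 < (M ^ k) i l}
  rcases s.eq_empty_or_nonempty with hs | hs
  · refine ⟨{i}, Set.singleton_nonempty i, Set.singleton_ne_univ i, ?_⟩
    rintro _ rfl l -
    by_contra hil
    exact Set.eq_empty_iff_forall_notMem.1 hs l
      ⟨1, one_pos, by simpa using (hM _ l).lt_of_ne' hil⟩
  · refine ⟨s, hs, fun huniv => hij (huniv.superset (Set.mem_univ j)), ?_⟩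
    rintro l ⟨k, -, hk⟩ l' hl'
    by_contra hll'
    refine hl' ⟨k + 1, k.succ_pos, ?_⟩
    rw [pow_succ, Matrix.mul_apply]
    exact Finset.sum_pos' (fun x _ => mul_nonneg (Matrix.pow_apply_nonneg hM k i x) (hM x l'))
      ⟨l, Finset.mem_univ l, mul_pos hk ((hM l l').lt_of_ne' hll')⟩

theorem eq_zero_of_subsingleton_of_not_isIrreducible {m : Type*} [Finite m] [Subsingleton m]
    {M : Matrix m m ℝ} (hM : ∀ i j, 0 ≤ M i j) (hirr : ¬M.IsIrreducible) : M = 0 := by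
  classical
  have := Fintype.ofFinite m
  simp only [Matrix.isIrreducible_iff_exists_pow_pos hM, not_forall] at hirr
  obtain ⟨i, j, hij⟩ := hirr
  ext k l
  rw [Subsingleton.elim k i, Subsingleton.elim l j, Matrix.zero_apply]
  by_contra h
  exact hij ⟨1, one_pos, by simpa using (hM i j).lt_of_ne' h⟩

variable {m : Type*} [Fintype m] [DecidableEq m]

theorem charpoly_eq_mul_of_forall_eq_zero {A : Type*} [CommRing A] (M : Matrix m m A)
    (p : m → Prop) [DecidablePred p] (h : ∀ i, p i → ∀ j, ¬p j → M i j = 0) :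
    M.charpoly =
      (M.toSquareBlockProp p).charpoly * (M.toSquareBlockProp fun i => ¬p i).charpoly := by
  have hblock : ∀ q : m → Prop, ∀ [DecidablePred q],
      M.charmatrix.toSquareBlockProp q = (M.toSquareBlockProp q).charmatrix := fun q _ => by
    ext i j : 1
    simp [Matrix.toSquareBlockProp_def, Matrix.charmatrix_apply, Matrix.diagonal_apply,
      Subtype.ext_iff]
  rw [Matrix.charpoly, Matrix.twoBlockTriangular_det' _ p, hblock, hblock]
  · rfl
  · intro i hi j hj
    have hij : i ≠ j := ne_of_mem_of_not_mem (s := {l | p l}) hi hj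
    rw [Matrix.charmatrix_apply_ne _ _ _ hij, h i hi j hj, map_zero, neg_zero]

theorem eigs_eq_add_of_forall_eq_zero (M : Matrix m m ℝ) (p : m → Prop) [DecidablePred p]
    (h : ∀ i, p i → ∀ j, ¬p j → M i j = 0) :
    eigs M = eigs (M.toSquareBlockProp p) + eigs (M.toSquareBlockProp fun i => ¬p i) := by
  rw [eigs, charpoly_eq_mul_of_forall_eq_zero _ p fun i hi j hj => by simp [h i hi j hj],
    Polynomial.roots_mul ((Matrix.charpoly_monic _).mul (Matrix.charpoly_monic _)).ne_zero]
  rfl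

theorem exists_filter_norm_eq_bind_nthRoots_of_isIrreducible {M : Matrix m m ℝ}
    (hM : M.IsIrreducible) {r : ℝ} (hr : 0 < r) (hspec : ∀ μ ∈ eigs M, ‖μ‖ ≤ r) :
    ∃ hs : Multiset ℕ, 0 ∉ hs ∧
      (eigs M).filter (‖·‖ = r) = hs.bind fun h => Polynomial.nthRoots h ((r : ℂ) ^ h) := by
  by_cases hF : (eigs M).filter (‖·‖ = r) = 0
  · exact ⟨0, by simp, by simp [hF]⟩
  have hr' : (r : ℂ) ≠ 0 := Complex.ofReal_ne_zero.2 hr.ne'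
  have hrot : ∀ μ ∈ (eigs M).filter (‖·‖ = r),
      ((eigs M).filter (‖·‖ = r)).map (μ / r * ·) = (eigs M).filter (‖·‖ = r) := by
    intro μ hμ
    obtain ⟨hμM, hμr⟩ := Multiset.mem_filter.1 hμ
    have hz : ‖μ / (r : ℂ)‖ = 1 := by
      rw [norm_div, hμr, Complex.norm_of_nonneg hr.le, div_self hr.ne']
    conv_rhs => rw [← eigs_map_mul_of_isIrreducible hM hr.le hspec hz
      (by rwa [div_mul_cancel₀ μ hr']), Multiset.filter_map]
    simp only [Function.comp_def, norm_mul, hz, one_mul]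
  obtain ⟨h, hh, k, hk⟩ := exists_eq_nsmul_nthRoots_of_map_mul hF
    (fun h0 => hr.ne (by simpa using (Multiset.mem_filter.1 h0).2)) hr' hrot
  refine ⟨Multiset.replicate k h, fun h0 => hh (Multiset.eq_of_mem_replicate h0).symm, ?_⟩
  rw [hk, Multiset.bind, Multiset.map_replicate, Multiset.join, Multiset.sum_replicate]

theorem exists_filter_norm_eq_bind_nthRoots {M : Matrix m m ℝ}
    (hM : ∀ i j, 0 ≤ M i j) {r : ℝ} (hr : 0 < r) (hspec : ∀ μ ∈ eigs M, ‖μ‖ ≤ r) :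
    ∃ hs : Multiset ℕ, 0 ∉ hs ∧
      (eigs M).filter (‖·‖ = r) = hs.bind fun h => Polynomial.nthRoots h ((r : ℂ) ^ h) := by
  classical
  induction hN : Fintype.card m using Nat.strong_induction_on generalizing m with
  | _ N ih =>
  by_cases hirr : M.IsIrreducible
  · exact exists_filter_norm_eq_bind_nthRoots_of_isIrreducible hirr hr hspec
  rcases subsingleton_or_nontrivial m with hm | hm
  · refine ⟨0, Multiset.notMem_zero 0, ?_⟩
    have hzero : ∀ μ ∈ eigs M, μ = 0 := by
      simp [eigs, eq_zero_of_subsingleton_of_not_isIrreducible hM hirr, Matrix.charpoly_zero]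
    rw [Multiset.zero_bind, Multiset.filter_eq_nil]
    exact fun μ hμ => by rw [hzero μ hμ, norm_zero]; exact hr.ne
  · obtain ⟨s, ⟨x, hx⟩, hs, hclosed⟩ := exists_invariant_of_not_isIrreducible hM hirr
    obtain ⟨y, hy⟩ := (Set.ne_univ_iff_exists_notMem s).1 hs
    have hadd := eigs_eq_add_of_forall_eq_zero M (· ∈ s) hclosed
    obtain ⟨hs₁, h0₁, hF₁⟩ := ih _ (hN ▸ Fintype.card_subtype_lt hy)
      (M := M.toSquareBlockProp (· ∈ s)) (fun i j => hM i j)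
      (fun μ hμ => hspec μ (hadd ▸ Multiset.mem_add.2 (Or.inl hμ))) rfl
    obtain ⟨hs₂, h0₂, hF₂⟩ := ih _ (hN ▸ Fintype.card_subtype_lt (not_not.2 hx))
      (M := M.toSquareBlockProp (· ∉ s)) (fun i j => hM i j)
      (fun μ hμ => hspec μ (hadd ▸ Multiset.mem_add.2 (Or.inr hμ))) rfl
    refine ⟨hs₁ + hs₂, by simp [h0₁, h0₂], ?_⟩
    rw [hadd, Multiset.filter_add, hF₁, hF₂, Multiset.add_bind]

theorem exists_isPeriods {M : Matrix m m ℝ} (hM : ∀ i j, 0 ≤ M i j) {r : ℝ} (hr : 0 < r)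
    (hspec : ∀ μ ∈ eigs M, ‖μ‖ ≤ r) : ∃ hs, IsPeriods M r hs := by
  obtain ⟨hs, h0, hF⟩ := exists_filter_norm_eq_bind_nthRoots hM hr hspec
  refine ⟨hs, isPeriods_iff_bind_nthRoots.2 ⟨?_, h0, hF⟩⟩
  rw [← Multiset.count_filter_of_pos (p := (‖·‖ = r)) (by simpa using hr.le), hF,
    Multiset.count_bind, Multiset.map_congr (g := fun _ => 1) rfl fun h hh =>
      count_nthRoots_pow_self (ne_of_mem_of_not_mem hh h0) (Complex.ofReal_ne_zero.2 hr.ne')]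
  simp

theorem IsPeriods.mem_eigs {M : Matrix m m ℝ} {r : ℝ} {hs : Multiset ℕ} (hper : IsPeriods M r hs)
    {μ : ℂ} (hμ : μ ∈ eigs M) (hμr : ‖μ‖ = r) : (r : ℂ) ∈ eigs M := by
  obtain ⟨hcard, -, hF⟩ := isPeriods_iff_bind_nthRoots.1 hper
  rw [← Multiset.count_pos, ← hcard, Multiset.card_pos]
  rintro rfl
  have : μ ∈ (eigs M).filter (‖·‖ = r) := Multiset.mem_filter.2 ⟨hμ, hμr⟩
  simp [hF] at this

theorem isPeriods_zero_replicate {M : Matrix m m ℝ} (hM : ∀ μ ∈ eigs M, μ = 0) :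
    IsPeriods M 0 (Multiset.replicate (Multiset.card (eigs M)) 1) := by
  have hrep := Multiset.eq_replicate_card.2 hM
  refine isPeriods_iff_bind_nthRoots.2 ⟨?_, ?_, ?_⟩
  · rw [Multiset.card_replicate, Complex.ofReal_zero, Multiset.count_eq_card.2 fun μ hμ =>
      (hM μ hμ).symm]
  · exact fun h0 => zero_ne_one (Multiset.eq_of_mem_replicate h0)
  · rw [Multiset.filter_eq_self.2 fun μ hμ => by rw [hM μ hμ, norm_zero], Multiset.bind_congr
      (g := fun _ => {(0 : ℂ)}) fun h hh => by
        rw [Multiset.eq_of_mem_replicate hh]; simp]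
    conv_lhs => rw [hrep]
    simp [Multiset.bind_singleton]

theorem exists_isPFEigenvalue_isPeriods [Nonempty m] {M : Matrix m m ℝ} (hM : ∀ i j, 0 ≤ M i j) :
    ∃ lam hs, IsPFEigenvalue M lam ∧ IsPeriods M lam hs := by
  obtain ⟨μ₀, hμ₀⟩ := exists_mem_eigs M
  obtain ⟨μ, hμ, hmax⟩ :=
    (eigs M).toFinset.exists_max_image (‖·‖) ⟨μ₀, Multiset.mem_toFinset.2 hμ₀⟩
  simp only [Multiset.mem_toFinset] at hμ hmax
  rcases (norm_nonneg μ).eq_or_lt with h0 | hpos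
  · have hzero : ∀ ν ∈ eigs M, ν = 0 := fun ν hν => norm_le_zero_iff.1 (h0 ▸ hmax ν hν)
    refine ⟨0, _, ⟨le_rfl, ?_, fun ν hν => by rw [hzero ν hν, norm_zero]⟩,
      isPeriods_zero_replicate hzero⟩
    rwa [Complex.ofReal_zero, ← hzero μ hμ]
  · obtain ⟨hs, hper⟩ := exists_isPeriods hM hpos hmax
    exact ⟨‖μ‖, hs, ⟨hpos.le, hper.mem_eigs hμ rfl, hmax⟩, hper⟩

end PeripheralSpectrum

section Fitting

theorem exists_fitting_idempotent {K A : Type*} [Field K] [Ring A] [Algebra K A] {f : A}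
    (hf : IsIntegral K f) :
    ∃ E G : A, IsIdempotentElem E ∧ (∃ n, f ^ n * E = 0) ∧ 1 - E = G * f ∧
      ∀ T, Commute T f → Commute T E := by
  obtain ⟨q, hq, hdvd⟩ := Polynomial.exists_eq_pow_rootMultiplicity_mul_and_not_dvd (minpoly K f)
    (minpoly.ne_zero hf) 0
  set n := (minpoly K f).rootMultiplicity 0
  rw [Polynomial.C_0, sub_zero] at hq hdvd
  obtain ⟨a, b, hab⟩ : IsCoprime ((Polynomial.X : K[X]) ^ (n + 1)) q :=
    (Polynomial.irreducible_X.coprime_iff_not_dvd.2 hdvd).pow_left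
  set E := Polynomial.aeval f (b * q)
  have hsub : 1 - E = Polynomial.aeval f (a * Polynomial.X ^ (n + 1)) := by
    rw [sub_eq_iff_eq_add, ← map_add, hab, map_one]
  have hnil : f ^ n * E = 0 := by
    calc f ^ n * E = Polynomial.aeval f (Polynomial.X ^ n * (b * q)) := by
          rw [map_mul _ (Polynomial.X ^ n), map_pow, Polynomial.aeval_X]
      _ = Polynomial.aeval f (b * minpoly K f) := by rw [hq]; ring_nf
      _ = 0 := by rw [map_mul, minpoly.aeval, mul_zero]
  have hmul : E * (1 - E) = 0 := by
    calc E * (1 - E) = Polynomial.aeval f (a * b * Polynomial.X * minpoly K f) := by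
          rw [hsub, ← map_mul, hq]; ring_nf
      _ = 0 := by rw [map_mul, minpoly.aeval, mul_zero]
  refine ⟨E, Polynomial.aeval f (a * Polynomial.X ^ n),
    (IsIdempotentElem.of_mul_add hmul (add_sub_cancel E 1)).1, ⟨n, hnil⟩, ?_, fun T hT =>
    Algebra.commute_of_mem_adjoin_singleton_of_commute
      (Polynomial.aeval_mem_adjoin_singleton K f) hT⟩
  rw [hsub, pow_succ, ← mul_assoc, map_mul, Polynomial.aeval_X]

theorem one_add_pow_mul_eq_sum {A : Type*} [Ring A] {f E : A} {k : ℕ} (hk : f ^ k * E = 0)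
    (n : ℕ) : (1 + f) ^ n * E = ∑ j ∈ Finset.range k, n.choose j • (f ^ j * E) := by
  have hzero : ∀ j, k ≤ j → f ^ j * E = 0 := fun j hj => by
    rw [← Nat.sub_add_cancel hj, pow_add, mul_assoc, hk, mul_zero]
  have hbinom : (1 + f) ^ n * E = ∑ j ∈ Finset.range (n + 1), n.choose j • (f ^ j * E) := by
    rw [add_comm, (Commute.one_right f).add_pow, Finset.sum_mul]
    refine Finset.sum_congr rfl fun j _ => ?_
    rw [one_pow, mul_one, ← Nat.cast_comm, mul_assoc, nsmul_eq_mul]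
  rw [hbinom, Finset.sum_subset (Finset.range_mono (le_max_left (n + 1) k)),
    Finset.sum_subset (Finset.range_mono (le_max_right (n + 1) k))]
  · intro j _ hj
    rw [hzero j (by simpa using hj), smul_zero]
  · intro j _ hj
    rw [Nat.choose_eq_zero_of_lt (by simpa using hj), zero_smul]

theorem pow_mul_add_mul_eq_sum {A : Type*} [Ring A] {T E : A} {h k : ℕ} (hcomm : Commute T E)
    (hk : (T ^ h - 1) ^ k * E = 0) (n i : ℕ) :
    T ^ (h * n + i) * E =
      ∑ j ∈ Finset.range k, n.choose j • ((T ^ h - 1) ^ j * E * T ^ i) := by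
  rw [pow_add, pow_mul, mul_assoc, (hcomm.pow_left i).eq, ← mul_assoc,
    ← add_sub_cancel 1 (T ^ h), one_add_pow_mul_eq_sum (by simpa only [add_sub_cancel] using hk),
    Finset.sum_mul]
  simp only [add_sub_cancel, smul_mul_assoc]

variable {m : Type*} [Fintype m] [DecidableEq m]

theorem mulVec_eq_smul_and_pow_ne_one {K : Type*} [Field K] {T E G : Matrix m m K} {h : ℕ}
    (hcomm : Commute T E) (hE : IsIdempotentElem E) (hG : 1 - E = G * (T ^ h - 1)) {μ : K}
    (hμ : μ ≠ 0) {v : m → K} (hv0 : v ≠ 0) (hv : (T * (1 - E)) *ᵥ v = μ • v) :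
    T *ᵥ v = μ • v ∧ μ ^ h ≠ 1 := by
  have hEv : E *ᵥ v = 0 := by
    refine (smul_eq_zero_iff_right hμ).1 ?_
    rw [← Matrix.mulVec_smul, ← hv, Matrix.mulVec_mulVec, ← mul_assoc, ← hcomm.eq, mul_assoc,
      hE.mul_one_sub_self, mul_zero, Matrix.zero_mulVec]
  have hsub : (1 - E) *ᵥ v = v := by
    rw [Matrix.sub_mulVec, hEv, Matrix.one_mulVec, sub_zero]
  have hTv : T *ᵥ v = μ • v := by
    rw [← hv, ← Matrix.mulVec_mulVec, hsub]
  have hpow : ∀ n : ℕ, T ^ n *ᵥ v = μ ^ n • v := fun n => by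
    induction n with
    | zero => rw [pow_zero, Matrix.one_mulVec, pow_zero, one_smul]
    | succ n ih =>
      rw [pow_succ, ← Matrix.mulVec_mulVec, hTv, Matrix.mulVec_smul, ih, smul_smul, pow_succ']
  refine ⟨hTv, fun hμh => hv0 ?_⟩
  rw [← hsub, hG, ← Matrix.mulVec_mulVec, Matrix.sub_mulVec, hpow, hμh, one_smul,
    Matrix.one_mulVec, sub_self, Matrix.mulVec_zero]

theorem mem_eigs_and_pow_ne_one {T E G : Matrix m m ℝ} {h : ℕ} (hcomm : Commute T E)
    (hE : IsIdempotentElem E) (hG : 1 - E = G * (T ^ h - 1)) {μ : ℂ} (hμ : μ ≠ 0)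
    (hμT : μ ∈ eigs (T * (1 - E))) : μ ∈ eigs T ∧ μ ^ h ≠ 1 := by
  set φ := Complex.ofRealHom.mapMatrix (m := m)
  obtain ⟨v, hv0, hv⟩ := (mem_eigs_iff_exists_mulVec_eq_smul _ _).1 hμT
  have hv' : (φ T * (1 - φ E)) *ᵥ v = μ • v := by
    rw [← map_one φ, ← map_sub, ← map_mul]
    exact hv
  have hG' : 1 - φ E = φ G * (φ T ^ h - 1) := by
    simpa only [map_sub, map_mul, map_pow, map_one] using congrArg φ hG
  obtain ⟨hTv, hμh⟩ := mulVec_eq_smul_and_pow_ne_one (hcomm.map φ) (hE.map φ) hG' hμ hv0 hv'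
  exact ⟨(mem_eigs_iff_exists_mulVec_eq_smul _ _).2 ⟨v, hv0, hTv⟩, hμh⟩

theorem exists_peripheral_idempotent (T : Matrix m m ℝ) (h : ℕ) :
    ∃ E, IsIdempotentElem E ∧ Commute T E ∧ (∃ n, (T ^ h - 1) ^ n * E = 0) ∧
      ∀ γ > 0, (∀ μ ∈ eigs T, μ ^ h = 1 ∨ ‖μ‖ < γ) → ∀ i j,
        (fun n : ℕ => (T ^ n * (1 - E)) i j) =O[atTop] fun n => γ ^ n := by
  obtain ⟨E, G, hE, hnil, hG, hcomm⟩ :=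
    exists_fitting_idempotent (Algebra.IsIntegral.isIntegral (R := ℝ) (T ^ h - 1))
  have hTE : Commute T E := hcomm T ((Commute.self_pow T h).sub_right (Commute.one_right T))
  refine ⟨E, hE, hTE, hnil, fun γ hγ hT i j => ?_⟩
  have hspec : ∀ μ ∈ eigs (T * (1 - E)), ‖μ‖ < γ := fun μ hμ => by
    rcases eq_or_ne μ 0 with rfl | hμ0
    · rwa [norm_zero]
    · obtain ⟨hμT, hμh⟩ := mem_eigs_and_pow_ne_one hTE hE hG hμ0 hμ
      exact (hT μ hμT).resolve_left hμh
  refine (isBigO_pow_apply hspec i j).congr' ?_ EventuallyEq.rfl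
  filter_upwards [eventually_ne_atTop 0] with n hn
  rw [((Commute.one_right T).sub_right hTE).mul_pow, hE.one_sub.pow_eq hn]

end Fitting

section NilpotencyIndex

/-- The binomial coefficient `n ↦ n.choose j` as a real polynomial in `n`. -/
noncomputable def choosePoly (j : ℕ) : ℝ[X] :=
  Polynomial.C ((j.factorial : ℝ)⁻¹) * descPochhammer ℝ j

theorem choosePoly_eval_natCast (j n : ℕ) : (choosePoly j).eval (n : ℝ) = n.choose j := by
  rw [choosePoly, Polynomial.eval_mul, Polynomial.eval_C, descPochhammer_eval_eq_descFactorial,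
    Nat.descFactorial_eq_factorial_mul_choose, Nat.cast_mul,
    inv_mul_cancel_left₀ (Nat.cast_ne_zero.2 j.factorial_ne_zero)]

theorem natDegree_choosePoly (j : ℕ) : (choosePoly j).natDegree = j := by
  rw [choosePoly, Polynomial.natDegree_C_mul (inv_ne_zero (Nat.cast_ne_zero.2 j.factorial_ne_zero)),
    descPochhammer_natDegree]

theorem tendsto_choose_div_choose {j k : ℕ} (hjk : j < k) :
    Tendsto (fun n : ℕ => (n.choose j / n.choose k : ℝ)) atTop (𝓝 0) := by
  have hdeg : (choosePoly j).degree < (choosePoly k).degree :=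
    Polynomial.degree_lt_degree (by rwa [natDegree_choosePoly, natDegree_choosePoly])
  simpa only [Function.comp_def, choosePoly_eval_natCast] using
    (Polynomial.div_tendsto_atTop_zero_of_degree_lt _ _ hdeg).comp tendsto_natCast_atTop_atTop

theorem nonneg_of_forall_sum_choose_add_nonneg {k : ℕ} {c e : ℕ → ℝ}
    (he : Tendsto e atTop (𝓝 0))
    (h : ∀ n : ℕ, 0 ≤ ∑ j ∈ Finset.range (k + 1), n.choose j * c j + e n) : 0 ≤ c k := by
  have hlow : Tendsto (fun n : ℕ => ∑ j ∈ Finset.range k, (n.choose j / n.choose k : ℝ) * c j)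
      atTop (𝓝 0) := by
    rw [← Finset.sum_const_zero (s := Finset.range k)]
    refine tendsto_finsetSum _ fun j hj => ?_
    simpa only [zero_mul] using
      (tendsto_choose_div_choose (Finset.mem_range.1 hj)).mul_const (c j)
  have herr : Tendsto (fun n : ℕ => e n / n.choose k) atTop (𝓝 0) := by
    refine squeeze_zero_norm' ?_ (tendsto_zero_iff_norm_tendsto_zero.1 he)
    filter_upwards [eventually_ge_atTop k] with n hn
    rw [norm_div, Real.norm_natCast]
    exact div_le_self (norm_nonneg _) (by exact_mod_cast Nat.choose_pos hn)
  have hlim := (hlow.add_const (c k)).add herr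
  rw [zero_add, add_zero] at hlim
  refine ge_of_tendsto hlim ?_
  filter_upwards [eventually_ge_atTop k] with n hn
  have hpos : (0 : ℝ) < n.choose k := by exact_mod_cast Nat.choose_pos hn
  refine (div_nonneg (h n) hpos.le).trans_eq ?_
  simp only [Finset.sum_range_succ, add_div, Finset.sum_div, mul_div_cancel_left₀ _ hpos.ne',
    div_mul_eq_mul_div]

variable {m : Type*} [Fintype m] [DecidableEq m]

theorem sub_one_pow_mul_mul_pow_apply_nonneg {T E : Matrix m m ℝ} (hT : ∀ i j, 0 ≤ T i j)
    {h k : ℕ} (hh : h ≠ 0) (hcomm : Commute T E) (hk : (T ^ h - 1) ^ (k + 1) * E = 0) {a b : m}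
    (herr : Tendsto (fun n : ℕ => (T ^ n * (1 - E)) a b) atTop (𝓝 0)) (i : ℕ) :
    0 ≤ ((T ^ h - 1) ^ k * E * T ^ i) a b := by
  have hshift : Tendsto (fun n => h * n + i) atTop atTop :=
    tendsto_atTop_mono (fun n => (Nat.le_mul_of_pos_left n (Nat.pos_of_ne_zero hh)).trans
      (Nat.le_add_right _ _)) tendsto_id
  refine nonneg_of_forall_sum_choose_add_nonneg
    (c := fun j => ((T ^ h - 1) ^ j * E * T ^ i) a b) (herr.comp hshift) fun n => ?_
  calc 0 ≤ (T ^ (h * n + i)) a b := Matrix.pow_apply_nonneg hT _ a b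
    _ = (T ^ (h * n + i) * E) a b + (T ^ (h * n + i) * (1 - E)) a b := by
        rw [← Matrix.add_apply, ← mul_add, add_sub_cancel, mul_one]
    _ = _ := by
        simp only [pow_mul_add_mul_eq_sum hcomm hk, ← Nat.cast_smul_eq_nsmul ℝ, Matrix.sum_apply,
          Matrix.smul_apply, smul_eq_mul, Function.comp_apply]

/-- The factorisation `T ^ h - 1 = (T - 1) * ∑ i < h, T ^ i` bounds the nilpotency index of
`T ^ h - 1` by that of `T - 1` as long as the geometric sum does not lower it; nonnegativity
excludes the cancellation. -/
theorem sub_one_pow_mul_eq_zero_of_nonneg {T E : Matrix m m ℝ} (hT : ∀ i j, 0 ≤ T i j) {h k : ℕ}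
    (hh : h ≠ 0) (hcomm : Commute T E)
    (herr : ∀ a b, Tendsto (fun n : ℕ => (T ^ n * (1 - E)) a b) atTop (𝓝 0))
    (hstep : ∀ W : Matrix m m ℝ, (T - 1) ^ (k + 1) * W = 0 → (T - 1) ^ k * W = 0)
    (hk : (T ^ h - 1) ^ (k + 1) * E = 0) : (T ^ h - 1) ^ k * E = 0 := by
  set g := ∑ i ∈ Finset.range h, T ^ i
  have hTg : Commute (T - 1) g :=
    Commute.sum_right _ _ _ fun i _ => (Commute.self_pow T i).sub_left (Commute.one_left _)
  have hpow : ∀ n, (T - 1) ^ n * g ^ n = (T ^ h - 1) ^ n := fun n => by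
    rw [← hTg.mul_pow, mul_geom_sum]
  have hgE : Commute g E := Commute.sum_left _ _ _ fun i _ => hcomm.pow_left i
  have hsum : ∑ i ∈ Finset.range h, (T ^ h - 1) ^ k * E * T ^ i = 0 := by
    calc ∑ i ∈ Finset.range h, (T ^ h - 1) ^ k * E * T ^ i = (T ^ h - 1) ^ k * E * g :=
          (Finset.mul_sum _ _ _).symm
      _ = (T - 1) ^ k * (g ^ (k + 1) * E) := by
          rw [pow_succ, mul_assoc (g ^ k), hgE.eq, ← mul_assoc, ← mul_assoc, hpow]
      _ = 0 := hstep _ (by rw [← mul_assoc, hpow, hk])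
  have hnonneg := fun i a b =>
    sub_one_pow_mul_mul_pow_apply_nonneg hT hh hcomm hk (herr a b) i
  ext a b
  refine le_antisymm ?_ (by simpa using hnonneg 0 a b)
  calc ((T ^ h - 1) ^ k * E) a b =
      ((T ^ h - 1) ^ k * E * T ^ 0 : Matrix m m ℝ) a b := by rw [pow_zero, mul_one]
    _ ≤ ∑ i ∈ Finset.range h, ((T ^ h - 1) ^ k * E * T ^ i) a b :=
        Finset.single_le_sum (f := fun i => ((T ^ h - 1) ^ k * E * T ^ i) a b)
          (fun i _ => hnonneg i a b) (Finset.mem_range.2 (Nat.pos_of_ne_zero hh))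
    _ = 0 := by rw [← Matrix.sum_apply, hsum, Matrix.zero_apply]

theorem smul_sub_one_pow_mul_mulVec_eq_zero_iff {M W : Matrix m m ℝ} {lam : ℝ} (hlam : lam ≠ 0)
    (k : ℕ) (w : m → ℝ) :
    ((lam⁻¹ • M - 1) ^ k * W) *ᵥ w = 0 ↔
      W *ᵥ w ∈ Module.End.genEigenspace (Matrix.toLin' M) lam k := by
  have hlin : Matrix.toLin' M - lam • 1 = Matrix.toLin' (lam • (lam⁻¹ • M - 1)) := by
    rw [smul_sub, smul_inv_smul₀ hlam, map_sub, map_smul, Matrix.toLin'_one]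
    rfl
  rw [Module.End.mem_genEigenspace_nat, LinearMap.mem_ker, hlin, ← Matrix.toLin'_pow, smul_pow,
    map_smul, LinearMap.smul_apply, smul_eq_zero_iff_right (pow_ne_zero k hlam),
    Matrix.toLin'_apply, Matrix.mulVec_mulVec]

theorem sub_one_pow_jordanIndex_mul_eq_zero {M W : Matrix m m ℝ} {lam : ℝ} (hlam : lam ≠ 0)
    {k : ℕ} (h : (lam⁻¹ • M - 1) ^ k * W = 0) :
    (lam⁻¹ • M - 1) ^ jordanIndex M lam * W = 0 := by
  refine Matrix.ext_of_mulVec_single fun i => ?_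
  rw [Matrix.zero_mulVec, smul_sub_one_pow_mul_mulVec_eq_zero_iff hlam, jordanIndex,
    ← Module.End.maxGenEigenspace_eq]
  refine Module.End.genEigenspace_le_maximal _ _ k
    ((smul_sub_one_pow_mul_mulVec_eq_zero_iff hlam k _).1 ?_)
  rw [h, Matrix.zero_mulVec]

theorem pow_sub_one_pow_jordanIndex_mul_eq_zero {M E : Matrix m m ℝ} (hM : ∀ i j, 0 ≤ M i j)
    {lam : ℝ} (hlam : 0 < lam) {h n : ℕ} (hh : h ≠ 0) (hcomm : Commute (lam⁻¹ • M) E)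
    (herr : ∀ a b, Tendsto (fun n : ℕ => ((lam⁻¹ • M) ^ n * (1 - E)) a b) atTop (𝓝 0))
    (hn : ((lam⁻¹ • M) ^ h - 1) ^ n * E = 0) :
    ((lam⁻¹ • M) ^ h - 1) ^ jordanIndex M lam * E = 0 := by
  have hT : ∀ i j, 0 ≤ (lam⁻¹ • M) i j := fun i j => mul_nonneg (inv_nonneg.2 hlam.le) (hM i j)
  rcases le_total n (jordanIndex M lam) with hle | hle
  · rw [← Nat.sub_add_cancel hle, pow_add, mul_assoc, hn, mul_zero]
  · refine Nat.decreasingInduction' (P := fun k => ((lam⁻¹ • M) ^ h - 1) ^ k * E = 0)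
      (fun k _ hk ih => sub_one_pow_mul_eq_zero_of_nonneg hT hh hcomm herr (fun W hW => ?_) ih)
      hle hn
    rw [← Nat.sub_add_cancel hk, pow_add, mul_assoc,
      sub_one_pow_jordanIndex_mul_eq_zero hlam.ne' hW, mul_zero]

end NilpotencyIndex

section RothblumExpansion

theorem eq_zero_of_tendsto_eval_natCast_zero {p : ℝ[X]}
    (hp : Tendsto (fun n : ℕ => p.eval (n : ℝ)) atTop (𝓝 0)) : p = 0 := by
  have hdeg : p.degree ≤ 0 := not_lt.1 fun hpos =>
    not_tendsto_nhds_of_tendsto_atTop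
      ((p.abs_tendsto_atTop hpos).comp tendsto_natCast_atTop_atTop) _ hp.abs
  rw [Polynomial.eq_C_of_degree_le_zero hdeg] at hp ⊢
  simp only [Polynomial.eval_C] at hp
  rw [tendsto_nhds_unique tendsto_const_nhds hp, Polynomial.C_0]

/-- The quasi-polynomial of period `h` with constituents `S 0, …, S (h - 1)`: on the residue class
`h * n + i` it is the polynomial `S i` evaluated at `n`. -/
def quasiEval {h : ℕ} [NeZero h] (S : Fin h → ℝ[X]) (n : ℕ) : ℝ :=
  (S (Fin.ofNat h n)).eval ((n / h : ℕ) : ℝ)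

theorem quasiEval_mul_add {h : ℕ} [NeZero h] (S : Fin h → ℝ[X]) (n : ℕ) (i : Fin h) :
    quasiEval S (h * n + i) = (S i).eval (n : ℝ) := by
  have hi : Fin.ofNat h (h * n + i) = i := by
    ext
    simp [Nat.mod_eq_of_lt i.2]
  rw [quasiEval, hi, Nat.mul_add_div (Nat.pos_of_neZero h), Nat.div_eq_of_lt i.2, add_zero]

variable {m : Type*} [Fintype m] [DecidableEq m]

theorem secModulus_nonneg (M : Matrix m m ℝ) (lam : ℝ) : 0 ≤ secModulus M lam :=
  Real.sSup_nonneg fun _ ⟨μ, _, _, hx⟩ => hx ▸ norm_nonneg μ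

theorem norm_le_secModulus {M : Matrix m m ℝ} {lam : ℝ} {μ : ℂ} (hμ : μ ∈ eigs M)
    (hlt : ‖μ‖ < lam) : ‖μ‖ ≤ secModulus M lam :=
  le_csSup ⟨lam, fun _ ⟨_, _, hν, hx⟩ => hx ▸ hν.le⟩ ⟨μ, hμ, hlt, rfl⟩

theorem secModulus_lt (M : Matrix m m ℝ) {lam : ℝ} (hlam : 0 < lam) : secModulus M lam < lam := by
  rw [secModulus]
  rcases Set.eq_empty_or_nonempty {x : ℝ | ∃ μ ∈ eigs M, ‖μ‖ < lam ∧ x = ‖μ‖} with hs | hs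
  · rwa [hs, Real.sSup_empty]
  · have hfin : {x : ℝ | ∃ μ ∈ eigs M, ‖μ‖ < lam ∧ x = ‖μ‖}.Finite := by
      classical
      refine ((eigs M).toFinset.finite_toSet.image (‖·‖)).subset ?_
      rintro x ⟨μ, hμ, -, rfl⟩
      exact ⟨μ, Multiset.mem_toFinset.2 hμ, rfl⟩
    obtain ⟨μ, -, hμ, hsup⟩ := hs.csSup_mem hfin
    rwa [hsup]

theorem pow_eq_one_or_norm_le_of_mem_eigs_inv_smul {M : Matrix m m ℝ} {lam : ℝ} (hlam : 0 < lam)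
    {h : ℕ} (hspec : ∀ μ ∈ eigs M, ‖μ‖ < lam ∨ μ ^ h = (lam : ℂ) ^ h) {μ : ℂ}
    (hμ : μ ∈ eigs (lam⁻¹ • M)) : μ ^ h = 1 ∨ ‖μ‖ ≤ secModulus M lam / lam := by
  rw [eigs_smul _ (inv_ne_zero hlam.ne'), Multiset.mem_map] at hμ
  obtain ⟨ν, hν, rfl⟩ := hμ
  refine (hspec ν hν).symm.imp (fun hpow => ?_) fun hlt => ?_
  · rw [mul_pow, hpow, ← mul_pow, ← Complex.ofReal_mul, inv_mul_cancel₀ hlam.ne',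
      Complex.ofReal_one, one_pow]
  · rw [norm_mul, Complex.norm_of_nonneg (inv_nonneg.2 hlam.le), div_eq_inv_mul]
    exact mul_le_mul_of_nonneg_left (norm_le_secModulus hν hlt) (inv_nonneg.2 hlam.le)

theorem isRothblumExpansion_iff {M : Matrix m m ℝ} {lam : ℝ} (hlam : 0 ≤ lam) {h : ℕ} [NeZero h]
    {S : Fin h → Matrix m m ℝ[X]} :
    IsRothblumExpansion M lam h S ↔ ∀ a b,
      (∀ i, (S i a b).natDegree ≤ jordanIndex M lam - 1) ∧
      ConvergesGeometrically (fun n => ((lam⁻¹ • M) ^ n) a b - quasiEval (fun i => S i a b) n) 0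
        (secModulus M lam / lam) := by
  simp only [convergesGeometrically_iff_forall_residue (NeZero.ne h)
    (div_nonneg (secModulus_nonneg M lam) hlam), quasiEval_mul_add, ← forall_and]
  exact ⟨fun hS a b i => ⟨(hS i a b).1, (hS i a b).2.2⟩,
    fun hS i a b => ⟨(hS a b i).1, (hS a b i).2.tendsto, (hS a b i).2⟩⟩

theorem exists_polynomial_eval_eq_pow_mul_apply {T E : Matrix m m ℝ} {h k : ℕ}
    (hcomm : Commute T E) (hk : (T ^ h - 1) ^ k * E = 0) (i : ℕ) (a b : m) :
    ∃ p : ℝ[X], p.natDegree ≤ k - 1 ∧ ∀ n : ℕ, p.eval (n : ℝ) = (T ^ (h * n + i) * E) a b := by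
  refine ⟨∑ j ∈ Finset.range k, Polynomial.C (((T ^ h - 1) ^ j * E * T ^ i) a b) * choosePoly j,
    Polynomial.natDegree_sum_le_of_forall_le _ _ fun j hj => ?_, fun n => ?_⟩
  · refine (Polynomial.natDegree_C_mul_le _ _).trans ?_
    rw [natDegree_choosePoly]
    exact Nat.le_sub_one_of_lt (Finset.mem_range.1 hj)
  · simp only [pow_mul_add_mul_eq_sum hcomm hk, ← Nat.cast_smul_eq_nsmul ℝ, Matrix.sum_apply,
      Matrix.smul_apply, smul_eq_mul, Polynomial.eval_finsetSum, Polynomial.eval_mul,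
      Polynomial.eval_C, choosePoly_eval_natCast, mul_comm]

theorem exists_isRothblumExpansion {M : Matrix m m ℝ} (hM : ∀ i j, 0 ≤ M i j) {lam : ℝ}
    (hlam : 0 < lam) {h : ℕ} (hh : h ≠ 0)
    (hspec : ∀ μ ∈ eigs M, ‖μ‖ < lam ∨ μ ^ h = (lam : ℂ) ^ h) :
    ∃ S, IsRothblumExpansion M lam h S := by
  have : NeZero h := ⟨hh⟩
  set T := lam⁻¹ • M
  set β := secModulus M lam / lam
  have hβ : 0 ≤ β := div_nonneg (secModulus_nonneg M lam) hlam.le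
  have hβ1 : β < 1 := (div_lt_one hlam).2 (secModulus_lt M hlam)
  obtain ⟨E, -, hcomm, ⟨n, hn⟩, hO⟩ := exists_peripheral_idempotent T h
  have herr : ∀ a b, ConvergesGeometrically (fun n => (T ^ n * (1 - E)) a b) 0 β := fun a b =>
    convergesGeometrically_iff_isBigO.2 ⟨hβ, hβ1, fun γ hγ _ => by
      simpa only [sub_zero] using hO γ (hβ.trans_lt hγ) (fun μ hμ =>
        (pow_eq_one_or_norm_le_of_mem_eigs_inv_smul hlam hspec hμ).imp_right
          fun hle => hle.trans_lt hγ) a b⟩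
  have hnil := pow_sub_one_pow_jordanIndex_mul_eq_zero hM hlam hh hcomm
    (fun a b => (herr a b).tendsto) hn
  choose S hdeg hS using fun (i : Fin h) => exists_polynomial_eval_eq_pow_mul_apply hcomm hnil i
  refine ⟨S, (isRothblumExpansion_iff hlam.le).2 fun a b => ⟨fun i => hdeg i a b, ?_⟩⟩
  convert herr a b using 2 with n
  have hn_eq : quasiEval (fun i => S i a b) n = (T ^ n * E) a b := by
    rw [quasiEval, hS, Fin.val_ofNat, Nat.div_add_mod]
  rw [hn_eq, ← Matrix.sub_apply, mul_sub, mul_one]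

theorem IsRothblumExpansion.unique {M : Matrix m m ℝ} {lam : ℝ} {h : ℕ}
    {S S' : Fin h → Matrix m m ℝ[X]} (hS : IsRothblumExpansion M lam h S)
    (hS' : IsRothblumExpansion M lam h S') : S = S' := by
  funext i
  ext1 a b
  rw [← sub_eq_zero]
  refine eq_zero_of_tendsto_eval_natCast_zero ?_
  simpa only [sub_sub_sub_cancel_left, sub_zero, Polynomial.eval_sub] using
    (hS' i a b).2.1.sub (hS i a b).2.1

theorem IsPeriods.lcm_ne_zero {M : Matrix m m ℝ} {lam : ℝ} {hs : Multiset ℕ}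
    (hper : IsPeriods M lam hs) : hs.lcm ≠ 0 := fun h =>
  absurd (hper.2.1 0 ((Multiset.lcm_eq_zero_iff _).1 h)) (by norm_num)

theorem IsPeriods.pow_lcm_eq {M : Matrix m m ℝ} {lam : ℝ} {hs : Multiset ℕ}
    (hper : IsPeriods M lam hs) {μ : ℂ} (hμ : μ ∈ eigs M) (hnorm : ‖μ‖ = lam) :
    μ ^ hs.lcm = (lam : ℂ) ^ hs.lcm := by
  obtain ⟨-, h0, heq⟩ := isPeriods_iff_bind_nthRoots.1 hper
  have hmem := Multiset.mem_filter (p := (‖·‖ = lam)).2 ⟨hμ, hnorm⟩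
  rw [heq, Multiset.mem_bind] at hmem
  obtain ⟨h, hh, hroot⟩ := hmem
  obtain ⟨d, hd⟩ := Multiset.dvd_lcm hh
  rw [Polynomial.mem_nthRoots (Nat.pos_of_ne_zero fun h' => h0 (h' ▸ hh))] at hroot
  rw [hd, pow_mul, pow_mul, hroot]

end RothblumExpansion

section ColumnSum

theorem ConvergesGeometrically.sum {E κ : Type*} [NormedAddCommGroup E] {t : Finset κ}
    (ht : t.Nonempty) {f : κ → ℕ → E} {l : κ → E} {β : ℝ}
    (hf : ∀ k ∈ t, ConvergesGeometrically (f k) (l k) β) :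
    ConvergesGeometrically (fun n => ∑ k ∈ t, f k n) (∑ k ∈ t, l k) β := by
  obtain ⟨k₀, hk₀⟩ := ht
  refine convergesGeometrically_iff_isBigO.2 ⟨(hf k₀ hk₀).1, (hf k₀ hk₀).2.1, fun γ hγ hγ1 => ?_⟩
  simp only [← Finset.sum_sub_distrib]
  exact IsBigO.fun_sum fun k hk => (convergesGeometrically_iff_isBigO.1 (hf k hk)).2.2 γ hγ hγ1

theorem sum_primitiveRoot_zpow_mul {K : Type*} [Field K] {ζ : K} {h : ℕ}
    (hζ : IsPrimitiveRoot ζ h) (z : ℤ) :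
    ∑ i : Fin h, ζ ^ (((i : ℕ) : ℤ) * z) = if (h : ℤ) ∣ z then (h : K) else 0 := by
  have hgeom : ∑ i : Fin h, ζ ^ (((i : ℕ) : ℤ) * z) = ∑ i ∈ Finset.range h, (ζ ^ z) ^ i := by
    rw [← Fin.sum_univ_eq_sum_range]
    refine Finset.sum_congr rfl fun i _ => ?_
    rw [mul_comm, _root_.zpow_mul, zpow_natCast]
  rw [hgeom]
  split_ifs with hz
  · simp only [(hζ.zpow_eq_one_iff_dvd z).2 hz, one_pow, Finset.sum_const, Finset.card_range,
      nsmul_one]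
  · have hpow : (ζ ^ z) ^ h = 1 := by
      rw [← zpow_natCast, zpow_comm, zpow_natCast, hζ.pow_eq_one, _root_.one_zpow]
    have hmul := mul_geom_sum (ζ ^ z) h
    rw [hpow, sub_self] at hmul
    exact (mul_eq_zero.1 hmul).resolve_left
      (sub_ne_zero.2 fun h1 => hz ((hζ.zpow_eq_one_iff_dvd z).1 h1))

variable {m : Type*} [Fintype m]

theorem asymptoticFormula_eq (lam : ℝ) {h : ℕ} [NeZero h] (S : Fin h → Matrix m m ℝ[X]) (u : m)
    (n : ℕ) :
    asymptoticFormula lam h S u n =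
      ((∑ k, quasiEval (fun i => S i k u) n : ℝ) : ℂ) * (lam : ℂ) ^ n := by
  have hdvd : ∀ j : Fin h, (h : ℤ) ∣ (n : ℤ) - ((j : ℕ) : ℤ) ↔ Fin.ofNat h n = j := fun j => by
    rw [← Int.modEq_iff_dvd, Int.natCast_modEq_iff, Fin.ext_iff, Fin.val_ofNat, Nat.ModEq,
      Nat.mod_eq_of_lt j.2, eq_comm]
  have hh : (h : ℂ) ≠ 0 := Nat.cast_ne_zero.2 (NeZero.ne h)
  rw [asymptoticFormula, Finset.sum_comm]
  simp only [← Finset.mul_sum,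
    sum_primitiveRoot_zpow_mul (Complex.isPrimitiveRoot_exp h (NeZero.ne h)), hdvd, mul_ite,
    mul_zero, Finset.sum_ite_eq, Finset.mem_univ, if_true]
  rw [mul_comm _ (h : ℂ), one_div, inv_mul_cancel_left₀ hh]
  rfl

variable [DecidableEq m] {M : Matrix m m ℝ} {lam c : ℝ} {u : m}

theorem tendsto_columnSum_pow_rpow (hPF : IsPFEigenvalue M lam) (hc : 0 < c)
    (hlower : ∀ n, c * lam ^ n ≤ ∑ k, (M ^ n) k u) :
    Tendsto (fun n : ℕ => (∑ k, (M ^ n) k u) ^ (1 / n : ℝ)) atTop (𝓝 lam) :=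
  tendsto_rpow_one_div_of_isBigO_pow hc hPF.1 hlower fun _ hγ =>
    IsBigO.fun_sum fun k _ => isBigO_pow_apply (fun μ hμ => (hPF.2.2 μ hμ).trans_lt hγ) k u

theorem IsRothblumExpansion.convergesGeometrically_columnSum_div {h : ℕ} [NeZero h]
    {S : Fin h → Matrix m m ℝ[X]} (hS : IsRothblumExpansion M lam h S) (hlam : 0 < lam)
    (hc : 0 < c) (hlower : ∀ n, c * lam ^ n ≤ ∑ k, (M ^ n) k u) :
    ConvergesGeometrically
      ((fun n => ((∑ k, (M ^ n) k u : ℝ) : ℂ)) / asymptoticFormula lam h S u) 1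
      (secModulus M lam / lam) := by
  have hratio : ConvergesGeometrically ((fun n => (∑ k, (M ^ n) k u) / lam ^ n) /
      fun n => ∑ k, quasiEval (fun i => S i k u) n) 1 (secModulus M lam / lam) := by
    refine convergesGeometrically_div_one_of_sub hc
      (fun n => (le_div_iff₀ (pow_pos hlam n)).2 (hlower n)) ?_
    convert ConvergesGeometrically.sum ⟨u, Finset.mem_univ u⟩
      fun k _ => ((isRothblumExpansion_iff hlam.le).1 hS k u).2 using 1
    · ext n
      simp only [Pi.sub_apply, Finset.sum_sub_distrib, Finset.mul_sum, smul_pow,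
        Matrix.smul_apply, smul_eq_mul, inv_pow, div_eq_inv_mul]
    · rw [Finset.sum_const_zero]
  convert hratio.ofReal using 1
  · ext n
    rw [Pi.div_apply, Pi.div_apply, asymptoticFormula_eq, Complex.ofReal_div, Complex.ofReal_div,
      Complex.ofReal_pow, div_div, mul_comm]
  · rw [Complex.ofReal_one]

end ColumnSum

section InvariantSubset

variable {ι S : Type*} [Fintype ι] [DecidableEq ι] [Semiring S] {P : Matrix ι ι S} {s : Set ι}

theorem pow_apply_eq_zero_of_forall_notMem (hs : ∀ j ∈ s, ∀ k ∉ s, P k j = 0) (n : ℕ) {j k : ι}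
    (hj : j ∈ s) (hk : k ∉ s) : (P ^ n) k j = 0 := by
  induction n generalizing k with
  | zero => rw [pow_zero, Matrix.one_apply_ne (ne_of_mem_of_not_mem hj hk).symm]
  | succ n ih =>
    rw [pow_succ', Matrix.mul_apply]
    refine Finset.sum_eq_zero fun i _ => ?_
    by_cases hi : i ∈ s
    · rw [hs i hi k hk, zero_mul]
    · rw [ih hi, mul_zero]

theorem submatrix_val_pow_of_forall_notMem [Fintype s] (hs : ∀ j ∈ s, ∀ k ∉ s, P k j = 0)
    (n : ℕ) :
    (P.submatrix Subtype.val Subtype.val : Matrix s s S) ^ n =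
      (P ^ n).submatrix Subtype.val Subtype.val := by
  induction n with
  | zero => rw [pow_zero, pow_zero, Matrix.submatrix_one _ Subtype.val_injective]
  | succ n ih =>
    ext k j
    rw [pow_succ', pow_succ', ih, Matrix.mul_apply, Matrix.submatrix_apply, Matrix.mul_apply]
    refine Fintype.sum_of_injective Subtype.val Subtype.val_injective _ _ (fun i hi => ?_)
      fun _ => rfl
    rw [Subtype.range_coe] at hi
    rw [pow_apply_eq_zero_of_forall_notMem hs n j.2 hi, mul_zero]

end InvariantSubset

theorem sum_coe_le_sum_of_nonneg {ι : Type*} [Fintype ι] (s : Set ι) [Fintype s] {f : ι → ℝ}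
    (hf : ∀ i, 0 ≤ f i) : ∑ i : s, f i ≤ ∑ i, f i := by
  rw [Finset.sum_set_coe (f := f)]
  exact Finset.sum_le_univ_sum_of_nonneg hf

namespace FiniteBasedAlgebra

variable {K : Subring ℂ} {R ι : Type*} [Ring R] [Algebra K R]

theorem ofReal_structConst (A : FiniteBasedAlgebra K R ι) (i j k : ι) :
    (A.structConst i j k : ℂ) = ((A.basis.repr (A.basis i * A.basis j) k : K) : ℂ) := by
  obtain ⟨x, -, hx⟩ := A.nonneg i j k
  rw [structConst, hx, Complex.ofReal_re]

theorem structConst_nonneg (A : FiniteBasedAlgebra K R ι) (i j k : ι) :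
    0 ≤ A.structConst i j k := by
  obtain ⟨x, hx0, hx⟩ := A.nonneg i j k
  rwa [structConst, hx, Complex.ofReal_re]

theorem repr_basis_mul_basis (A : FiniteBasedAlgebra K R ι) (i j k : ι) :
    (Algebra.TensorProduct.basis ℂ A.basis).repr
      (Algebra.TensorProduct.basis ℂ A.basis i * Algebra.TensorProduct.basis ℂ A.basis j) k =
      A.structConst i j k := by
  rw [Algebra.TensorProduct.basis_apply, Algebra.TensorProduct.basis_apply,
    Algebra.TensorProduct.tmul_mul_tmul, one_mul, Algebra.TensorProduct.basis_repr_tmul, one_smul,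
    Finsupp.mapRange_apply, ofReal_structConst]
  rfl

variable [Fintype ι] (A : FiniteBasedAlgebra K R ι) (a : ι → ℝ≥0)

theorem preActionMatrix_nonneg (k j : ι) : 0 ≤ A.preActionMatrix a k j :=
  Finset.sum_nonneg fun i _ => mul_nonneg (a i).2 (A.structConst_nonneg i j k)

theorem actionMatrix_nonneg (k j : A.component a) : 0 ≤ A.actionMatrix a k j :=
  A.preActionMatrix_nonneg a k j

theorem preActionMatrix_apply_eq_zero_of_mem_component {j k : ι} (hj : j ∈ A.component a)
    (hk : k ∉ A.component a) : A.preActionMatrix a k j = 0 := by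
  by_contra hne
  exact hk (.trans _ _ _ hj (.symm _ _ (.rel _ _ hne)))

theorem elem_eq_sum_smul :
    A.elem a = ∑ i, ((a i : ℝ) : ℂ) • Algebra.TensorProduct.basis ℂ A.basis i := by
  simp only [elem, Algebra.TensorProduct.basis_repr_symm_apply']

variable [DecidableEq ι]

theorem leftMulMatrix_elem :
    Algebra.leftMulMatrix (Algebra.TensorProduct.basis ℂ A.basis) (A.elem a) =
      (A.preActionMatrix a).map Complex.ofReal := by
  ext k j
  simp only [Algebra.leftMulMatrix_eq_repr_mul, elem_eq_sum_smul, Finset.sum_mul, map_sum,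
    Finsupp.finsetSum_apply, smul_mul_assoc, map_smul, Finsupp.smul_apply, repr_basis_mul_basis,
    preActionMatrix, Matrix.map_apply, Matrix.of_apply, smul_eq_mul, Complex.ofReal_sum,
    Complex.ofReal_mul]

theorem repr_elem_pow_mul_basis (n : ℕ) (k j : ι) :
    (Algebra.TensorProduct.basis ℂ A.basis).repr
      (A.elem a ^ n * Algebra.TensorProduct.basis ℂ A.basis j) k =
      (A.preActionMatrix a ^ n) k j := by
  rw [← Algebra.leftMulMatrix_eq_repr_mul, map_pow, leftMulMatrix_elem, ← map_ofReal_pow,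
    Matrix.map_apply]

theorem repr_elem_pow (n : ℕ) (k : ι) :
    (Algebra.TensorProduct.basis ℂ A.basis).repr (A.elem a ^ n) k =
      (A.preActionMatrix a ^ n) k A.e := by
  have hone : Algebra.TensorProduct.basis ℂ A.basis A.e = 1 := by
    rw [Algebra.TensorProduct.basis_apply, A.basis_e, Algebra.TensorProduct.one_def]
  rw [← repr_elem_pow_mul_basis, hone, mul_one]

theorem powCoeff_eq (n : ℕ) (k : ι) : A.powCoeff a n k = (A.preActionMatrix a ^ n) k A.e := by
  rw [powCoeff, repr_elem_pow, Complex.ofReal_re]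

theorem preActionMatrix_pow_apply (n : ℕ) (k j : ι) :
    (A.preActionMatrix a ^ n) k j = ∑ i, A.powCoeff a n i * A.structConst i j k := by
  rw [← Complex.ofReal_inj, ← repr_elem_pow_mul_basis,
    ← (Algebra.TensorProduct.basis ℂ A.basis).sum_repr (A.elem a ^ n)]
  simp only [repr_elem_pow, ← powCoeff_eq, Finset.sum_mul, map_sum, Finsupp.finsetSum_apply,
    smul_mul_assoc, map_smul, Finsupp.smul_apply, repr_basis_mul_basis, smul_eq_mul,
    Complex.ofReal_sum, Complex.ofReal_mul]

theorem actionMatrix_pow (n : ℕ) :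
    A.actionMatrix a ^ n = (A.preActionMatrix a ^ n).submatrix Subtype.val Subtype.val :=
  submatrix_val_pow_of_forall_notMem
    (fun _ hj _ hk => A.preActionMatrix_apply_eq_zero_of_mem_component a hj hk) n

theorem b_eq_sum_actionMatrix_pow (n : ℕ) :
    A.b a n = ∑ k, (A.actionMatrix a ^ n) k (A.unitVertex a) := by
  simp only [b, powCoeff_eq, actionMatrix_pow]
  refine (Fintype.sum_of_injective Subtype.val Subtype.val_injective _ _ (fun k hk => ?_)
    fun _ => rfl).symm
  rw [Subtype.range_coe] at hk
  exact pow_apply_eq_zero_of_forall_notMem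
    (fun _ hj _ hk => A.preActionMatrix_apply_eq_zero_of_mem_component a hj hk) n
    (A.unitVertex a).2 hk

theorem sum_preActionMatrix_pow_le (n : ℕ) :
    ∑ k, ∑ j, (A.preActionMatrix a ^ n) k j ≤ (∑ i, ∑ k, ∑ j, A.structConst i j k) * A.b a n := by
  have hcoeff : ∀ k, 0 ≤ A.powCoeff a n k := fun k => by
    rw [powCoeff_eq]
    exact Matrix.pow_apply_nonneg (A.preActionMatrix_nonneg a) n k A.e
  calc ∑ k, ∑ j, (A.preActionMatrix a ^ n) k j
      = ∑ i, (∑ k, ∑ j, A.structConst i j k) * A.powCoeff a n i := by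
        simp only [preActionMatrix_pow_apply, mul_comm, Finset.mul_sum]
        rw [Finset.sum_congr rfl fun k _ => Finset.sum_comm, Finset.sum_comm]
    _ ≤ ∑ i, (∑ k, ∑ j, A.structConst i j k) * A.b a n :=
        Finset.sum_le_sum fun i _ => mul_le_mul_of_nonneg_left
          (Finset.single_le_sum (fun k _ => hcoeff k) (Finset.mem_univ i))
          (Finset.sum_nonneg fun k _ => Finset.sum_nonneg fun j _ => A.structConst_nonneg i j k)
    _ = _ := (Finset.sum_mul _ _ _).symm

theorem sum_actionMatrix_pow_le (n : ℕ) :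
    ∑ k, ∑ j, (A.actionMatrix a ^ n) k j ≤ ∑ k, ∑ j, (A.preActionMatrix a ^ n) k j := by
  have hnonneg := Matrix.pow_apply_nonneg (A.preActionMatrix_nonneg a) n
  simp only [actionMatrix_pow, Matrix.submatrix_apply]
  calc ∑ k : A.component a, ∑ j : A.component a, (A.preActionMatrix a ^ n) k j
      ≤ ∑ k : A.component a, ∑ j, (A.preActionMatrix a ^ n) k j :=
        Finset.sum_le_sum fun k _ => sum_coe_le_sum_of_nonneg _ (hnonneg k)
    _ ≤ ∑ k, ∑ j, (A.preActionMatrix a ^ n) k j :=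
        sum_coe_le_sum_of_nonneg (f := fun k => ∑ j, (A.preActionMatrix a ^ n) k j) _
          fun k => Finset.sum_nonneg fun j _ => hnonneg k j

/-- The product `c ^ n * c_j` is determined by `c ^ n`, so the column of the unit controls all
entries of the powers of the action matrix, and hence their spectral growth. -/
theorem exists_pos_forall_mul_pow_le_b {lam : ℝ} (hPF : IsPFEigenvalue (A.actionMatrix a) lam) :
    ∃ c > 0, ∀ n, c * lam ^ n ≤ A.b a n := by
  set C := ∑ i, ∑ k, ∑ j, A.structConst i j k
  have hgrowth : ∀ n, lam ^ n ≤ C * A.b a n := fun n => by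
    have hpow := norm_pow_le_sum_pow_apply (A.actionMatrix_nonneg a) hPF.2.1 n
    rw [Complex.norm_of_nonneg hPF.1] at hpow
    exact hpow.trans ((A.sum_actionMatrix_pow_le a n).trans (A.sum_preActionMatrix_pow_le a n))
  have hC0 : 0 ≤ C := Finset.sum_nonneg fun i _ => Finset.sum_nonneg fun k _ =>
    Finset.sum_nonneg fun j _ => A.structConst_nonneg i j k
  have hC : 0 < C := hC0.lt_of_ne' <| left_ne_zero_of_mul
    (one_pos.trans_le (pow_zero lam ▸ hgrowth 0)).ne'
  exact ⟨C⁻¹, inv_pos.2 hC, fun n => (inv_mul_le_iff₀ hC).2 (hgrowth n)⟩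

end FiniteBasedAlgebra

theorem mainTheorem6 {K : Subring ℂ} {R ι : Type*} [Ring R] [Algebra K R]
    [Fintype ι] [DecidableEq ι] (A : FiniteBasedAlgebra K R ι) (a : ι → NNReal) :
    ∃ (lam : ℝ) (hs : Multiset ℕ),
      IsPFEigenvalue (A.actionMatrix a) lam ∧
      IsPeriods (A.actionMatrix a) lam hs ∧
      Filter.Tendsto (fun n : ℕ => (A.b a n) ^ (1 / (n : ℝ))) Filter.atTop (nhds lam) ∧
      (lam = 0 → ∀ᶠ n in Filter.atTop, A.b a n = 0) ∧
      (0 < lam →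
        ∃ S : Fin hs.lcm → Matrix (A.component a) (A.component a) (Polynomial ℝ),
          IsRothblumExpansion (A.actionMatrix a) lam hs.lcm S ∧
          (∀ S', IsRothblumExpansion (A.actionMatrix a) lam hs.lcm S' → S' = S) ∧
          Asymptotics.IsEquivalent Filter.atTop (fun n : ℕ => (A.b a n : ℂ))
            (asymptoticFormula lam hs.lcm S (A.unitVertex a)) ∧
          ConvergesGeometrically
            (fun n : ℕ => (A.b a n : ℂ) /
              asymptoticFormula lam hs.lcm S (A.unitVertex a) n)
            1 (secModulus (A.actionMatrix a) lam / lam)) := by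
  have : Nonempty (A.component a) := ⟨A.unitVertex a⟩
  obtain ⟨lam, hs, hPF, hper⟩ := exists_isPFEigenvalue_isPeriods (A.actionMatrix_nonneg a)
  obtain ⟨c, hc, hlower⟩ := A.exists_pos_forall_mul_pow_le_b a hPF
  simp only [A.b_eq_sum_actionMatrix_pow a] at hlower ⊢
  refine ⟨lam, hs, hPF, hper, tendsto_columnSum_pow_rpow hPF hc hlower, fun h0 => ?_,
    fun hlam => ?_⟩
  · have hnil := pow_card_eq_zero_of_forall_mem_eigs fun μ hμ =>
      norm_le_zero_iff.1 ((hPF.2.2 μ hμ).trans_eq h0)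
    filter_upwards [eventually_ge_atTop (Fintype.card (A.component a))] with n hn
    simp only [pow_eq_zero_of_le hn hnil, Matrix.zero_apply, Finset.sum_const_zero]
  · have : NeZero hs.lcm := ⟨hper.lcm_ne_zero⟩
    obtain ⟨S, hS⟩ := exists_isRothblumExpansion (A.actionMatrix_nonneg a) hlam hper.lcm_ne_zero
      fun μ hμ => (hPF.2.2 μ hμ).lt_or_eq.imp_right (hper.pow_lcm_eq hμ)
    have hratio := hS.convergesGeometrically_columnSum_div hlam hc hlower
    exact ⟨S, hS, fun S' hS' => hS'.unique hS, hratio.isEquivalent, hratio⟩
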